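/- Let $n\ge 1$ and $1\le k\le n$ be integers with $k>n/2$, and let $B_1$ be the open unit ball of $\mathbb{R}^n$. There is a constant $\delta=\delta(n,k)>0$ with the following property. Let $W\in C^2(\overline{B}_1)$ take values in the positive definite symmetric $n\times n$ matrices, with $|W_{ij}(x)-\delta_{ij}|\le\delta$ for all $x\in B_1$ and all $i,j$. Let $w\in C^{0,1}(B_1)$ be a Lipschitz viscosity subsolution in $B_1$ of $$\sigma_k^{1/k}\bigl[\lambda(W\,D^2u\,W)\bigr]=0,\qquad \lambda(W\,D^2u\,W)\in\Gamma_k^+,$$ that is, whenever $x_0\in B_1$, $U\subset B_1$ is an open neighbourhood of $x_0$, $\varphi\in C^2(U)$, $\varphi(x_0)=w(x_0)$ and $\varphi\ge w$ in $U$, then $\lambda(W\,D^2\varphi\,W)(x_0)\in\Gamma_k^+$ and $\sigma_k^{1/k}[\lambda(W\,D^2\varphi\,W)](x_0)\ge 0$. Here $\lambda(A)\in\mathbb{R}^n$ denotes the eigenvalues of the symmetric matrix $A$, $\sigma_j$ is the $j$-th elementary symmetric function, and $\Gamma_k^+=\{\lambda\in\mathbb{R}^n:\sigma_1(\lambda)>0,\dots,\sigma_k(\lambda)>0\}$.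 Assume that there are signed Borel measures $\mu^{ij}=\mu^{ji}$ on $B_1$ (each a difference of two positive Borel measures that are finite on compact subsets of $B_1$) such that $$\int_{B_1} w\,\partial_{ij}\phi\,dx=\int_{B_1}\phi\,d\mu^{ij}\qquad\text{for all }\phi\in C_c^\infty(B_1),\ 1\le i,j\le n.$$ Then $w$ is punctually second order differentiable at almost every $x_0\in B_1$: there is a polynomial $P$ of degree at most $2$ with $w(x)=P(x)+o(|x-x_0|^2)$ as $x\to x_0$. -/

import Mathlib

open MeasureTheory Filter Topology Asymptotics
open scoped ContDiff

noncomputable section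

namespace SigmaK

/-- The `j`-th elementary symmetric function `σ_j` on `ℝⁿ`. -/
def sigma {n : ℕ} (j : ℕ) (lam : Fin n → ℝ) : ℝ :=
  ∑ s ∈ (Finset.univ : Finset (Fin n)).powersetCard j, ∏ i ∈ s, lam i

/-- The open cone `Γ_k⁺ = {λ ∈ ℝⁿ : σ_1(λ) > 0, …, σ_k(λ) > 0}`. -/
def Gam (n k : ℕ) : Set (Fin n → ℝ) :=
  {lam | ∀ j : ℕ, 1 ≤ j → j ≤ k → 0 < sigma j lam}

open Classical in
/-- The map `λ` sending a symmetric matrix to the vector of its eigenvalues, with multiplicity.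
It is only ever applied to symmetric matrices (see `isHermitian_conj_hess`); the value `0` on other
matrices is a dummy. -/
def eigenvals {n : ℕ} (A : Matrix (Fin n) (Fin n) ℝ) : Fin n → ℝ :=
  if h : A.IsHermitian then h.eigenvalues else 0

/-- The Hessian matrix `D²φ(x) = (∂_i ∂_j φ(x))_{ij}`. -/
def hess {n : ℕ} (φ : EuclideanSpace ℝ (Fin n) → ℝ) (x : EuclideanSpace ℝ (Fin n)) :
    Matrix (Fin n) (Fin n) ℝ :=
  Matrix.of fun i j =>
    fderiv ℝ (fun y => fderiv ℝ φ y (EuclideanSpace.single j (1 : ℝ))) x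
      (EuclideanSpace.single i (1 : ℝ))

/-- For symmetric `W` and `φ` of class `C²` near `x`, the matrix `W ∘ D²φ(x) ∘ W` is symmetric. -/
theorem isHermitian_conj_hess {n : ℕ} {W : Matrix (Fin n) (Fin n) ℝ} (hW : W.IsHermitian)
    {U : Set (EuclideanSpace ℝ (Fin n))} (hU : IsOpen U) {φ : EuclideanSpace ℝ (Fin n) → ℝ}
    (hφ : ContDiffOn ℝ 2 φ U) {x : EuclideanSpace ℝ (Fin n)} (hx : x ∈ U) :
    (W * hess φ x * W).IsHermitian := by
  have hc : ContDiffAt ℝ 2 φ x := hφ.contDiffAt (hU.mem_nhds hx)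
  have hd : DifferentiableAt ℝ (fderiv ℝ φ) x :=
    (hc.fderiv_right (m := 1) (by norm_num)).differentiableAt (by norm_num)
  have hs : IsSymmSndFDerivAt ℝ φ x := hc.isSymmSndFDerivAt (by simp)
  have hh : (hess φ x).IsHermitian := by
    ext i j
    have key : ∀ v u : EuclideanSpace ℝ (Fin n),
        fderiv ℝ (fun y => fderiv ℝ φ y v) x u = fderiv ℝ (fderiv ℝ φ) x u v := by
      intro v u
      rw [fderiv_clm_apply hd (differentiableAt_const v)]
      simp
    simp only [hess, Matrix.conjTranspose_apply, Matrix.of_apply, star_trivial, key]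
    exact hs.eq _ _
  have h := Matrix.isHermitian_conjTranspose_mul_mul W hh
  rwa [hW.eq] at h

/-- `w ∈ C(B_1)` is a viscosity subsolution in `B_1` of
`σ_k^{1/k}[λ(W ∘ D²u ∘ W)] = 0`, `λ(W ∘ D²u ∘ W) ∈ Γ_k⁺`: whenever a `C²` function `φ` touches `w`
from above at a point `x₀`, one has `σ_k^{1/k}[λ(W ∘ D²φ ∘ W)](x₀) ≥ 0` and
`λ(W ∘ D²φ ∘ W)(x₀) ∈ Γ_k⁺`. -/
def IsViscositySubsolution {n : ℕ} (k : ℕ)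
    (W : EuclideanSpace ℝ (Fin n) → Matrix (Fin n) (Fin n) ℝ)
    (w : EuclideanSpace ℝ (Fin n) → ℝ) : Prop :=
  ContinuousOn w (Metric.ball 0 1) ∧
    ∀ x₀ ∈ Metric.ball (0 : EuclideanSpace ℝ (Fin n)) 1,
      ∀ U : Set (EuclideanSpace ℝ (Fin n)), IsOpen U → x₀ ∈ U → U ⊆ Metric.ball 0 1 →
        ∀ φ : EuclideanSpace ℝ (Fin n) → ℝ, ContDiffOn ℝ 2 φ U →
          φ x₀ = w x₀ → (∀ x ∈ U, w x ≤ φ x) →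
            0 ≤ (sigma k (eigenvals (W x₀ * hess φ x₀ * W x₀))) ^ (1 / (k : ℝ)) ∧
              eigenvals (W x₀ * hess φ x₀ * W x₀) ∈ Gam n k

/-- The second distributional derivatives of `w` in `B_1` are signed Borel (Radon) measures
`μ^{ij} = μ^{ji}`: each `μ^{ij}` is a difference `μp i j - μm i j` of two positive Borel measures
which are finite on the compact subsets of `B_1`, and
`∫ w ∂_{ij}φ dx = ∫ φ dμ^{ij}` for all `φ ∈ C_c^∞(B_1)`. -/
def SecondDerivsAreMeasures {n : ℕ} (w : EuclideanSpace ℝ (Fin n) → ℝ) : Prop :=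
  ∃ μp μm : Fin n → Fin n → Measure (EuclideanSpace ℝ (Fin n)),
    (∀ i j, μp i j = μp j i ∧ μm i j = μm j i) ∧
    (∀ i j, ∀ K ⊆ Metric.ball (0 : EuclideanSpace ℝ (Fin n)) 1, IsCompact K →
      μp i j K < ⊤ ∧ μm i j K < ⊤) ∧
    ∀ i j, ∀ φ : EuclideanSpace ℝ (Fin n) → ℝ, ContDiff ℝ ∞ φ → HasCompactSupport φ →
      tsupport φ ⊆ Metric.ball 0 1 →
        ∫ x in Metric.ball 0 1, w x * hess φ x i j =
          (∫ x in Metric.ball 0 1, φ x ∂(μp i j)) - ∫ x in Metric.ball 0 1, φ x ∂(μm i j)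

/-- `w` is punctually second order differentiable at `x₀`: there is a paraboloid `P` (a polynomial
of degree at most `2`) with `w(x) = P(x) + o(|x - x₀|²)` as `x → x₀`. -/
def PunctuallySecondOrderDifferentiableAt {n : ℕ} (w : EuclideanSpace ℝ (Fin n) → ℝ)
    (x₀ : EuclideanSpace ℝ (Fin n)) : Prop :=
  ∃ P : MvPolynomial (Fin n) ℝ, P.totalDegree ≤ 2 ∧
    (fun x => w x - MvPolynomial.eval (fun i => x i) P) =o[𝓝 x₀] fun x => ‖x - x₀‖ ^ 2

end SigmaK

end

/-! The assumption `k > n / 2` enters through one inequality: every component of a vector in Γ_k⁺ is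
at least minus the mean of the components (`Gam_lower_bound`). Away from its centre, the cusp
|x|^(1/(n+1)) has as Hessian a positive multiple of I - g e⊗e, with e the radial direction and g = 2
- 1/(n+1). This violates the inequality strictly, and still does after conjugation by W close to I
and subtraction of a positive semidefinite matrix (`eigenvals_cusp_notMem_Gam`). Hence no such cusp
can touch a subsolution from above away from its vertex, and cusps are barriers (`le_cusp_barrier`).
If Q is quadratic with D²Q = F ≤ L·I, the oscillation of w - Q at scale ηr inside B_r is at most (2
sup|w - Q| + L r²) times a power of η (`abs_sub_le_of_subsolution`).

At almost every x₀, differentiation of measures gives a symmetric F such that D²w - F dx, tested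
against φ supported in B_r, is o(rⁿ) sup|φ| (`ae_exists_weak_hess`). Put v = w - ½⟨Fx, x⟩ and
suppose v is within s r² of an affine function on B_r. Subtract that function and mollify at scale
ηr. The barrier estimate bounds the change made by mollification by a small multiple of (s + L) r²,
while the mollified function has small Hessian, so it is nearly affine. Choosing η first and then
the measure error, v is within ((s + γ)/2)(r/4)² of an affine function on B_{r/4}
(`affineApprox_improvement`).

Iterating drives the relative error to zero along the radii r₀ 4⁻ʲ. The approximating affine
functions then converge fast enough for a single one to serve at all scales, and adding back ½⟨Fx,
x⟩ gives the expansion of w. -/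

namespace SigmaK

/-! ### Newton inequalities and the lower bound on Γ_k⁺. -/

section Algebra

open Polynomial

/-- Arithmetic–harmonic mean inequality for positive numbers `x ∈ m`, phrased through the
coefficients of `∏ (X + x)`. -/
theorem sq_card_mul_coeff_zero_le (m : Multiset ℝ) (hm : ∀ x ∈ m, 0 < x) :
    0 < ((m.map fun x => X + C x).prod).coeff 0 ∧
      0 ≤ ((m.map fun x => X + C x).prod).coeff 1 ∧
      0 ≤ m.sum ∧
      (m.card : ℝ) ^ 2 * ((m.map fun x => X + C x).prod).coeff 0 ≤
        ((m.map fun x => X + C x).prod).coeff 1 * m.sum := by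
  induction m using Multiset.induction_on with
  | empty => simp [coeff_one]
  | cons x m ih =>
    obtain ⟨h0, h1, hs, h⟩ := ih fun y hy => hm y (Multiset.mem_cons_of_mem hy)
    have hx : 0 < x := hm x (Multiset.mem_cons_self x m)
    set P := (m.map fun x => X + C x).prod with hP
    have e0 : ((X + C x) * P).coeff 0 = x * P.coeff 0 := by simp [mul_coeff_zero]
    have e1 : ((X + C x) * P).coeff 1 = P.coeff 0 + x * P.coeff 1 := by
      rw [add_mul, coeff_add, coeff_C_mul, show (1 : ℕ) = 0 + 1 from rfl, coeff_X_mul]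
    simp only [Multiset.map_cons, Multiset.prod_cons, Multiset.card_cons, Multiset.sum_cons]
    rw [← hP, e0, e1]
    refine ⟨by positivity, by positivity, by positivity, ?_⟩
    push_cast
    -- The cross term created by the new element: AM-GM combined with the induction hypothesis,
    -- compared after squaring.
    have key : 2 * (m.card : ℝ) * x * P.coeff 0 ≤ x ^ 2 * P.coeff 1 + P.coeff 0 * m.sum := by
      have hsq : (2 * (m.card : ℝ) * x * P.coeff 0) ^ 2 ≤
          (x ^ 2 * P.coeff 1 + P.coeff 0 * m.sum) ^ 2 := by
        have h2 := mul_le_mul_of_nonneg_left h (by positivity : 0 ≤ 4 * x ^ 2 * P.coeff 0)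
        nlinarith [sq_nonneg (x ^ 2 * P.coeff 1 - P.coeff 0 * m.sum)]
      exact le_of_sq_le_sq hsq (by positivity)
    nlinarith [mul_le_mul_of_nonneg_left h hx.le]

/-- Rolle: counted with multiplicity, differentiation loses at most one real root, while the degree
drops by at least one unless it is already zero. -/
theorem splits_derivative_of_splits {p : ℝ[X]} (hp : p.roots.card = p.natDegree) :
    p.derivative.roots.card = p.derivative.natDegree := by
  apply le_antisymm (card_roots' _)
  have h := card_roots_le_derivative p
  have h2 := natDegree_derivative_le p
  omega

theorem splits_iterate_derivative_of_splits {p : ℝ[X]} (hp : p.roots.card = p.natDegree) (m : ℕ) :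
    (derivative^[m] p).roots.card = (derivative^[m] p).natDegree := by
  induction m with
  | zero => simpa
  | succ m ih => rw [Function.iterate_succ_apply']; exact splits_derivative_of_splits ih

/-- A Newton type inequality for real-rooted polynomials with positive coefficients. -/
theorem sq_natDegree_mul_coeff_zero_le {q : ℝ[X]} {k : ℕ} (hk : 1 ≤ k)
    (hq : q.roots.card = q.natDegree) (hd : q.natDegree = k) (hpos : ∀ i ≤ k, 0 < q.coeff i) :
    (k : ℝ) ^ 2 * q.coeff 0 * q.coeff k ≤ q.coeff 1 * q.coeff (k - 1) := by
  set m := q.roots.map Neg.neg with hm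
  have hq0 : q ≠ 0 := by
    rintro rfl; have := hpos 0 (Nat.zero_le _); simp at this
  have hfac : q = C (q.coeff k) * (m.map fun x => X + C x).prod := by
    have := C_leadingCoeff_mul_prod_multiset_X_sub_C hq
    rw [leadingCoeff, hd] at this
    conv_lhs => rw [← this]
    congr 2
    rw [hm, Multiset.map_map]
    refine Multiset.map_congr rfl fun x _ => ?_
    simp [sub_eq_add_neg]
  have hmc : m.card = k := by rw [hm, Multiset.card_map, hq, hd]
  -- Positive coefficients exclude roots in [0, ∞), so the negated roots are positive and the
  -- arithmetic–harmonic inequality applies to them.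
  have hmp : ∀ x ∈ m, 0 < x := by
    intro x hx
    obtain ⟨y, hy, rfl⟩ := Multiset.mem_map.1 hx
    by_contra hcon
    have hy0 : 0 ≤ y := by simpa using hcon
    have hroot : q.eval y = 0 := (mem_roots hq0).1 hy
    have : 0 < q.eval y := by
      rw [eval_eq_sum_range, hd, Finset.sum_range_succ']
      have : 0 ≤ ∑ i ∈ Finset.range k, q.coeff (i + 1) * y ^ (i + 1) := by
        refine Finset.sum_nonneg fun i hi => mul_nonneg (hpos _ ?_).le (pow_nonneg hy0 _)
        have := Finset.mem_range.1 hi; omega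
      have := hpos 0 (Nat.zero_le _)
      simp; linarith
    linarith
  obtain ⟨-, -, -, h⟩ := sq_card_mul_coeff_zero_le m hmp
  set P := (m.map fun x => X + C x).prod with hP
  have hc : ∀ i, q.coeff i = q.coeff k * P.coeff i := by
    intro i; conv_lhs => rw [hfac]
    rw [coeff_C_mul]
  have hsum : P.coeff (k - 1) = m.sum := by
    rw [hP, Multiset.prod_X_add_C_coeff m (by omega), hmc, show k - (k - 1) = 1 by omega]
    simp [Multiset.esymm, Multiset.powersetCard_one]
  rw [hc 0, hc 1, hc (k - 1), hsum]
  have hkp := hpos k le_rfl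
  rw [hmc] at h
  nlinarith [mul_le_mul_of_nonneg_left h (mul_pos hkp hkp).le]

theorem coeff_prod_X_add_C {n : ℕ} (lam : Fin n → ℝ) {j : ℕ} (hj : j ≤ n) :
    (∏ i, (X + C (lam i))).coeff j = sigma (n - j) lam := by
  rw [Finset.prod_X_add_C_coeff _ _ (by simpa using hj)]
  simp [sigma]

/-- For `k > n / 2`, every component of a vector in `Γ_k⁺` is bounded below by minus the mean of
the components. -/
theorem Gam_lower_bound {n k : ℕ} (hkn : k ≤ n) (hk : n < 2 * k) {lam : Fin n → ℝ}
    (h : lam ∈ Gam n k) (i : Fin n) : 0 ≤ n * lam i + ∑ j, lam j := by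
  have hn : 1 ≤ n := Nat.one_le_iff_ne_zero.2 (by rintro rfl; exact i.elim0)
  have hk1 : 1 ≤ k := by omega
  have hsig1 : sigma 1 lam = ∑ j, lam j := by
    simp [sigma, Finset.powersetCard_one]
  have hpos1 : 0 < ∑ j, lam j := hsig1 ▸ h 1 le_rfl hk1
  rcases le_or_gt 0 (lam i) with h0 | h0
  · positivity
  set a := -lam i with ha
  have ha0 : 0 < a := by simpa [ha] using h0
  -- The coefficients of `s` are the elementary symmetric functions with `lam i` omitted. Factoring
  -- out X - a gives σ_t(λ) = σ_t(λ|i) - a σ_{t-1}(λ|i).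
  set s : ℝ[X] := ∏ j ∈ Finset.univ.erase i, (X + C (lam j)) with hs
  have hsm : s.Monic := monic_prod_of_monic _ _ fun j _ => monic_X_add_C _
  have hsd : s.natDegree = n - 1 := by
    rw [hs, natDegree_prod_of_monic _ _ fun j _ => monic_X_add_C _]
    simp
  have hlead : s.coeff (n - 1) = 1 := hsd ▸ hsm.coeff_natDegree
  have hsplit : s.roots.card = s.natDegree := by
    rw [hsd, hs, roots_prod _ _ (Finset.prod_ne_zero_iff.2 fun j _ => X_add_C_ne_zero _)]
    simp
  have hp : ∏ j, (X + C (lam j)) = (X - C a) * s := by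
    rw [hs, ← Finset.mul_prod_erase _ _ (Finset.mem_univ i)]
    simp [ha]
  have hcoef : ∀ j, j + 1 ≤ n → sigma (n - (j + 1)) lam = s.coeff j - a * s.coeff (j + 1) := by
    intro j hj
    rw [← coeff_prod_X_add_C lam hj, hp, sub_mul, coeff_sub, coeff_X_mul, coeff_C_mul]
  have hpos : ∀ t, t + 1 ≤ k → 0 < s.coeff (n - 1 - t) := by
    intro t ht
    induction t with
    | zero => simp [hlead]
    | succ t ih =>
      have h1 := hcoef (n - 1 - (t + 1)) (by omega)
      have h2 := h (n - (n - 1 - (t + 1) + 1)) (by omega) (by omega)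
      have h3 := ih (by omega)
      rw [show n - 1 - (t + 1) + 1 = n - 1 - t by omega] at h1 h2
      have := mul_pos ha0 h3
      linarith
  -- For k = n, σ_n(λ) = -a σ_{n-1}(λ|i) would be negative.
  have hkn' : k < n := by
    rcases hkn.lt_or_eq with h' | h'
    · exact h'
    exfalso
    have h1 : (∏ j, (X + C (lam j))).coeff 0 = _ := coeff_prod_X_add_C lam (Nat.zero_le n)
    rw [hp, mul_coeff_zero] at h1
    have h2 := hpos (n - 1) (by omega)
    have h3 := h n hn h'.ge
    simp at h1 h2
    have := mul_pos ha0 h2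
    linarith
  -- With m = n - k - 1, the coefficient of `s` at m is σ_k(λ|i). Differentiating `s` m times brings
  -- it to the constant term of a real-rooted polynomial of degree k.
  obtain ⟨m, rfl⟩ : ∃ m, n = m + 1 + k := ⟨n - k - 1, by omega⟩
  have hm0 : a * s.coeff (m + 1) < s.coeff m := by
    have h1 := hcoef m (by omega)
    have h2 := h k hk1 le_rfl
    rw [show m + 1 + k - (m + 1) = k by omega] at h1
    linarith
  have hsum : s.coeff (m + k - 1) - a = ∑ j, lam j := by
    have h1 := hcoef (m + k - 1) (by omega)
    rw [show m + k - 1 + 1 = m + 1 + k - 1 by omega, hlead,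
      show m + 1 + k - (m + 1 + k - 1) = 1 by omega, hsig1] at h1
    linarith
  have hposc : ∀ t ≤ k, 0 < s.coeff (t + m) := by
    intro t ht
    rcases Nat.lt_or_ge 0 t with h' | h'
    · have := hpos (k - t) (by omega)
      rwa [show m + 1 + k - 1 - (k - t) = t + m by omega] at this
    · obtain rfl : t = 0 := by omega
      have h1 := hpos (k - 1) (by omega)
      rw [show m + 1 + k - 1 - (k - 1) = m + 1 by omega] at h1
      rw [zero_add]
      exact (mul_pos ha0 h1).trans hm0
  set q := derivative^[m] s with hq
  have hqc : ∀ t, q.coeff t = ((t + m).descFactorial m : ℝ) * s.coeff (t + m) := by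
    intro t; rw [hq, coeff_iterate_derivative, nsmul_eq_mul]
  have hqpos : ∀ t ≤ k, 0 < q.coeff t := by
    intro t ht
    rw [hqc]
    refine mul_pos ?_ (hposc t ht)
    exact_mod_cast Nat.descFactorial_pos.2 (by omega)
  have hqd : q.natDegree = k := by
    apply le_antisymm
    · have := natDegree_iterate_derivative s m
      rw [hsd] at this; rw [hq]; omega
    · exact le_natDegree_of_ne_zero (hqpos k le_rfl).ne'
  have key := sq_natDegree_mul_coeff_zero_le hk1 (splits_iterate_derivative_of_splits hsplit m)
    hqd hqpos
  rw [← hq] at key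
  have f0 : q.coeff 0 = (m.factorial : ℝ) * s.coeff m := by
    rw [hqc, zero_add, Nat.descFactorial_self]
  have f1 : q.coeff 1 = (m + 1 : ℝ) * m.factorial * s.coeff (m + 1) := by
    rw [hqc, add_comm 1 m]
    congr 1
    have : (m + 1).descFactorial m = (m + 1) * m.factorial := by
      have := Nat.descFactorial_succ (m + 1) m
      rw [Nat.descFactorial_self, Nat.add_sub_cancel_left, one_mul] at this
      rw [← this, Nat.factorial_succ]
    rw [this]; push_cast; ring
  have fk : (k : ℝ) * q.coeff k = (m + k : ℝ) * ((k - 1 + m).descFactorial m : ℝ) := by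
    rw [hqc, show k + m = m + 1 + k - 1 by omega, hlead, mul_one]
    obtain ⟨l, rfl⟩ : ∃ l, k = l + 1 := ⟨k - 1, by omega⟩
    have h1 := Nat.succ_descFactorial (l + m) m
    rw [show m + 1 + (l + 1) - 1 = l + m + 1 by omega, show l + 1 - 1 + m = l + m by omega]
    rw [show l + m + 1 - m = l + 1 by omega] at h1
    have h2 : (((l + 1) * (l + m + 1).descFactorial m : ℕ) : ℝ) =
      ((l + m + 1) * (l + m).descFactorial m : ℕ) := by rw [h1]
    push_cast at h2 ⊢
    linarith
  have fk1 : q.coeff (k - 1) = ((k - 1 + m).descFactorial m : ℝ) * s.coeff (m + k - 1) := by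
    rw [hqc, show k - 1 + m = m + k - 1 by omega]
  have hD : (0 : ℝ) < ((k - 1 + m).descFactorial m : ℝ) := by
    exact_mod_cast Nat.descFactorial_pos.2 (by omega)
  have hF : (0 : ℝ) < m.factorial := by exact_mod_cast Nat.factorial_pos m
  set e := s.coeff (m + k - 1) with he
  have hsm1 : 0 < s.coeff (m + 1) := by simpa [add_comm] using hposc 1 hk1
  -- Newton's inequality for `q` with the factorials cancelled: it bounds σ_k(λ|i) by a multiple of
  -- σ_{k-1}(λ|i) σ_1(λ|i). With `hm0` this bounds a by a multiple of e = σ_1(λ|i).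
  have hkk : (k : ℝ) * (m + k) * s.coeff m ≤ (m + 1) * s.coeff (m + 1) * e := by
    have e1 : (k : ℝ) ^ 2 * q.coeff 0 * q.coeff k =
        (m.factorial * ((k - 1 + m).descFactorial m : ℝ)) * (k * (m + k) * s.coeff m) := by
      rw [f0]; linear_combination (k : ℝ) * (m.factorial : ℝ) * s.coeff m * fk
    have e2 : q.coeff 1 * q.coeff (k - 1) =
        (m.factorial * ((k - 1 + m).descFactorial m : ℝ)) *
          ((m + 1) * s.coeff (m + 1) * e) := by
      rw [f1, fk1]; ring
    rw [e1, e2] at key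
    exact le_of_mul_le_mul_left key (mul_pos hF hD)
  have hkpos : (0 : ℝ) < k := by exact_mod_cast hk1
  have h4 : (k : ℝ) * (m + k) * (a * s.coeff (m + 1)) < (m + 1) * s.coeff (m + 1) * e :=
    lt_of_lt_of_le (mul_lt_mul_of_pos_left hm0 (by positivity)) hkk
  have h5 : (k : ℝ) * (m + k) * a < (m + 1) * e := by
    refine lt_of_mul_lt_mul_right ?_ hsm1.le
    linarith
  have hkm : (m : ℝ) + 2 ≤ k := by
    have : m + 2 ≤ k := by omega
    exact_mod_cast this
  -- Here k > n/2 is decisive, in the form m + 2 ≤ k; the coefficient inequality is an equality when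
  -- n = 2k - 1. The outcome (n + 1) a < e is the claim, because Σ λ_j = e - a.
  have h6 : ((m : ℝ) + 1) * ((m + 2 + k) * a) ≤ k * (m + k) * a := by
    have : ((m : ℝ) + 1) * (m + 2 + k) ≤ k * (m + k) := by nlinarith
    nlinarith
  have h7 : ((m : ℝ) + 2 + k) * a < e := by
    have hm1 : (0 : ℝ) ≤ (m : ℝ) + 1 := by positivity
    exact lt_of_mul_lt_mul_left (h6.trans_lt h5) hm1
  have hli : lam i = -a := by simp [ha]
  rw [hli, ← hsum]
  push_cast
  linarith

end Algebra

/-! ### The cusp Hessian lies outside the cone. -/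

section Matrices

open Matrix

/-- The quadratic form of a symmetric matrix is bounded below by any lower bound of its
eigenvalues. -/
theorem neg_mul_dotProduct_le_of_eigenvalues {n : ℕ} {A : Matrix (Fin n) (Fin n) ℝ}
    (hA : A.IsHermitian) {c : ℝ} (hc : ∀ i, 0 ≤ hA.eigenvalues i + c) (x : Fin n → ℝ) :
    0 ≤ x ⬝ᵥ (A *ᵥ x) + c * (x ⬝ᵥ x) := by
  set U : Matrix (Fin n) (Fin n) ℝ := (hA.eigenvectorUnitary).1 with hU
  have hUU : U * Uᴴ = 1 := by
    rw [hU, ← star_eq_conjTranspose]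
    exact Unitary.coe_mul_star_self hA.eigenvectorUnitary
  have hsp : A = U * diagonal hA.eigenvalues * Uᴴ := by
    conv_lhs => rw [hA.spectral_theorem]
    rw [Unitary.conjStarAlgAut_apply]
    rfl
  have h1 : A + c • (1 : Matrix (Fin n) (Fin n) ℝ) =
      U * diagonal (fun i => hA.eigenvalues i + c) * Uᴴ := by
    have : diagonal (fun i => hA.eigenvalues i + c) =
        diagonal hA.eigenvalues + c • (1 : Matrix (Fin n) (Fin n) ℝ) := by
      ext i j
      by_cases h : i = j <;> simp [h, Matrix.diagonal]
    rw [this, mul_add, add_mul, ← hsp]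
    rw [Matrix.mul_smul, Matrix.smul_mul, mul_one, hUU]
  have h2 : (A + c • (1 : Matrix (Fin n) (Fin n) ℝ)).PosSemidef := by
    rw [h1]
    exact PosSemidef.mul_mul_conjTranspose_same (posSemidef_diagonal_iff.2 hc) U
  have h3 := h2.dotProduct_mulVec_nonneg x
  simpa [add_mulVec, dotProduct_add, smul_mulVec, dotProduct_smul] using h3

/-- The basis-free form of the eigenvalue bound: A + (tr A / n) I is positive semidefinite. It can
be tested on the radial direction without diagonalising W D²φ W. -/
theorem quadForm_lower_bound_of_mem_Gam {n k : ℕ} (hkn : k ≤ n) (hk : n < 2 * k)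
    {A : Matrix (Fin n) (Fin n) ℝ} (hA : A.IsHermitian) (h : eigenvals A ∈ Gam n k)
    (x : Fin n → ℝ) : 0 ≤ n * (x ⬝ᵥ (A *ᵥ x)) + A.trace * (x ⬝ᵥ x) := by
  rcases Nat.eq_zero_or_pos n with rfl | hn
  · simp [Matrix.trace, dotProduct]
  have hn' : (0 : ℝ) < n := by exact_mod_cast hn
  have he : eigenvals A = hA.eigenvalues := dif_pos hA
  rw [he] at h
  have htr : A.trace = ∑ i, hA.eigenvalues i := by
    simpa using hA.trace_eq_sum_eigenvalues
  have := neg_mul_dotProduct_le_of_eigenvalues hA (c := A.trace / n) (fun i => by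
    have := Gam_lower_bound hkn hk h i
    rw [← htr] at this
    have h2 : hA.eigenvalues i + A.trace / n = (n * hA.eigenvalues i + A.trace) / n := by
      field_simp
    rw [h2]; positivity) x
  have h2 := mul_nonneg hn'.le this
  have h3 : (n : ℝ) * (x ⬝ᵥ A *ᵥ x + A.trace / n * (x ⬝ᵥ x)) =
      n * (x ⬝ᵥ A *ᵥ x) + A.trace * (x ⬝ᵥ x) := by
    field_simp
  rwa [h3] at h2

/-- Size of the perturbation of the identity allowed in dimension `n`. -/
noncomputable def pertSize (n : ℕ) : ℝ := 1 / (20 * n ^ 4)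

/-- At t = u = 0 and T = n the left side is 2n - (n + 1) g = -1. The size of d keeps the total
perturbation below 1; the dominant terms are of order n·|t| ≤ n³ d. -/
theorem pert_scalar_estimate {n d t u T g : ℝ} (hn1 : 1 ≤ n) (hd0 : 0 < d)
    (hd4 : n ^ 4 * d = 1 / 20) (ht1 : |t| ≤ n ^ 2 * d) (hu0 : 0 ≤ u)
    (hu1 : u ≤ n * (n * d) ^ 2) (htr : T ≤ n + 2 * (n * d) + n ^ 2 * d ^ 2)
    (hg : g = 2 - 1 / (n + 1)) :
    n * (1 + 2 * t + u - g * (1 + t) ^ 2) + (T - g * (1 + 2 * t + u)) < 0 := by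
  have hg1 : g ≤ 2 := by rw [hg]; have : (0 : ℝ) ≤ 1 / (n + 1) := by positivity
                         linarith
  have hg0 : 0 ≤ g := by
    rw [hg]
    have : (1 : ℝ) / (n + 1) ≤ 1 := by
      rw [div_le_one (by positivity)]; linarith
    linarith
  have hgn : (n + 1) * g = 2 * n + 1 := by rw [hg]; field_simp; ring
  have hn2 : (1 : ℝ) ≤ n ^ 2 := one_le_pow₀ hn1
  have b1 : n ^ 3 * d ≤ 1 / 20 := by
    rw [← hd4]
    exact mul_le_mul_of_nonneg_right (pow_le_pow_right₀ hn1 (by norm_num)) hd0.le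
  have b2 : n * d ≤ 1 / 20 := by
    rw [← hd4]; gcongr; exact le_self_pow₀ hn1 (by norm_num)
  have b3 : n ^ 4 * d ^ 2 ≤ 1 / 400 := by
    have : d ≤ 1 / 20 := by nlinarith
    calc n ^ 4 * d ^ 2 = (n ^ 4 * d) * d := by ring
      _ ≤ 1 / 20 * (1 / 20) := by rw [hd4]; gcongr
      _ = 1 / 400 := by norm_num
  have b4 : n ^ 2 * d ^ 2 ≤ 1 / 400 := by
    refine le_trans ?_ b3
    exact mul_le_mul_of_nonneg_right (pow_le_pow_right₀ hn1 (by norm_num)) (by positivity)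
  have c1 : n * |t| ≤ 1 / 20 := by
    have := mul_le_mul_of_nonneg_left ht1 (by positivity : (0 : ℝ) ≤ n)
    nlinarith
  have c2 : n * u ≤ 1 / 400 := by
    have := mul_le_mul_of_nonneg_left hu1 (by positivity : (0 : ℝ) ≤ n)
    nlinarith
  have c3 : |t| ≤ 1 / 20 := by nlinarith [abs_nonneg t]
  have ht2 := neg_abs_le t
  have ht3 := le_abs_self t
  have e1 : n * (1 + 2 * t + u - g * (1 + t) ^ 2) +
      (T - g * (1 + 2 * t + u)) =
      n + T - (n + 1) * g + 2 * (n * t) + n * u - 2 * (g * (n * t)) -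
        g * n * t ^ 2 - 2 * (g * t) - g * u := by ring
  rw [e1, hgn]
  have f1 : -(g * (n * t)) ≤ 2 * (1 / 20) := by
    have : n * (-t) ≤ 1 / 20 := by nlinarith
    nlinarith [mul_le_mul_of_nonneg_left this hg0]
  have f2 : -(g * t) ≤ 2 * (1 / 20) := by
    have : -t ≤ 1 / 20 := by linarith
    nlinarith [mul_le_mul_of_nonneg_left this hg0]
  have f3 : 0 ≤ g * n * t ^ 2 := by positivity
  have f4 : 0 ≤ g * u := by positivity
  have f5 : n * t ≤ 1 / 20 := by nlinarith
  linarith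

/-- For A = W (I - g e⊗e) W, the left side is n e·Ae + tr A, the quantity that membership in Γ_k⁺
would force to be nonnegative. -/
theorem quadForm_pert_neg {n : ℕ} (hn : 1 ≤ n) {W : Matrix (Fin n) (Fin n) ℝ}
    (hWd : ∀ i j, |W i j - (1 : Matrix (Fin n) (Fin n) ℝ) i j| ≤ pertSize n)
    {e : Fin n → ℝ} (he : e ⬝ᵥ e = 1) {g : ℝ} (hg : g = 2 - 1 / (n + 1)) :
    n * ((W *ᵥ e) ⬝ᵥ (W *ᵥ e) - g * (e ⬝ᵥ (W *ᵥ e)) ^ 2) +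
      ((W * W).trace - g * ((W *ᵥ e) ⬝ᵥ (W *ᵥ e))) < 0 := by
  have hn1 : (1 : ℝ) ≤ n := by exact_mod_cast hn
  set d := pertSize n with hd
  have hd0 : 0 < d := by rw [hd, pertSize]; positivity
  have hd4 : (n : ℝ) ^ 4 * d = 1 / 20 := by rw [hd, pertSize]; field_simp
  set E := W - 1 with hE
  have hEd : ∀ i j, |E i j| ≤ d := hWd
  have hWE : W = 1 + E := by simp [hE]
  have he1 : ∀ i, |e i| ≤ 1 := by
    intro i
    have : e i * e i ≤ e ⬝ᵥ e :=
      Finset.single_le_sum (f := fun i => e i * e i) (fun j _ => mul_self_nonneg _)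
        (Finset.mem_univ i)
    rw [he] at this
    exact abs_le_one_iff_mul_self_le_one.2 this
  have hEe : ∀ i, |(E *ᵥ e) i| ≤ n * d := by
    intro i
    calc |(E *ᵥ e) i| = |∑ j, E i j * e j| := rfl
      _ ≤ ∑ j, |E i j * e j| := Finset.abs_sum_le_sum_abs _ _
      _ ≤ ∑ j : Fin n, d := by
        refine Finset.sum_le_sum fun j _ => ?_
        rw [abs_mul]
        nlinarith [hEd i j, he1 j, abs_nonneg (E i j), abs_nonneg (e j)]
      _ = n * d := by simp
  set t := e ⬝ᵥ (E *ᵥ e) with ht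
  set u := (E *ᵥ e) ⬝ᵥ (E *ᵥ e) with hu
  have ht1 : |t| ≤ n ^ 2 * d := by
    calc |t| ≤ ∑ i, |e i * (E *ᵥ e) i| :=
          Finset.abs_sum_le_sum_abs (fun i => e i * (E *ᵥ e) i) _
      _ ≤ ∑ i : Fin n, n * d := by
        refine Finset.sum_le_sum fun j _ => ?_
        rw [abs_mul]
        nlinarith [hEe j, he1 j, abs_nonneg ((E *ᵥ e) j), abs_nonneg (e j)]
      _ = n ^ 2 * d := by simp; ring
  have hu0 : 0 ≤ u := Finset.sum_nonneg fun i _ => mul_self_nonneg _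
  have hu1 : u ≤ n * (n * d) ^ 2 := by
    calc u ≤ ∑ i : Fin n, (n * d) ^ 2 := by
          refine Finset.sum_le_sum fun i _ => ?_
          rw [← sq, ← sq_abs]
          exact pow_le_pow_left₀ (abs_nonneg _) (hEe i) 2
      _ = n * (n * d) ^ 2 := by simp
  have hWe : W *ᵥ e = e + E *ᵥ e := by rw [hWE, add_mulVec, one_mulVec]
  have h1 : (W *ᵥ e) ⬝ᵥ (W *ᵥ e) = 1 + 2 * t + u := by
    rw [hWe, add_dotProduct, dotProduct_add, dotProduct_add, he, dotProduct_comm (E *ᵥ e) e]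
    ring
  have h2 : e ⬝ᵥ (W *ᵥ e) = 1 + t := by rw [hWe, dotProduct_add, he]
  have htr : (W * W).trace ≤ n + 2 * (n * d) + n ^ 2 * d ^ 2 := by
    have hEE : (E * E).trace ≤ n ^ 2 * d ^ 2 := by
      calc (E * E).trace = ∑ i, ∑ j, E i j * E j i := by
            simp [Matrix.trace, Matrix.mul_apply]
        _ ≤ ∑ i : Fin n, ∑ j : Fin n, d ^ 2 := by
            refine Finset.sum_le_sum fun i _ => Finset.sum_le_sum fun j _ => ?_
            refine (le_abs_self _).trans ?_
            rw [abs_mul, sq]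
            exact mul_le_mul (hEd i j) (hEd j i) (abs_nonneg _) hd0.le
        _ = n ^ 2 * d ^ 2 := by simp; ring
    have hE1 : E.trace ≤ n * d := by
      calc E.trace ≤ ∑ i : Fin n, d :=
            Finset.sum_le_sum fun i _ => (le_abs_self _).trans (hEd i i)
        _ = n * d := by simp
    have : (W * W).trace = n + 2 * E.trace + (E * E).trace := by
      rw [hWE]
      simp [add_mul, mul_add, Matrix.trace_add]
      ring
    linarith
  rw [h1, h2]
  exact pert_scalar_estimate hn1 hd0 hd4 ht1 hu0 hu1 htr hg

/-- The Hessian of a radially concave cusp, minus a nonnegative matrix, never satisfies the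
`Γ_k⁺` condition when `k > n / 2` and `W` is close to the identity. -/
theorem eigenvals_cusp_notMem_Gam {n k : ℕ} (hkn : k ≤ n) (hk : n < 2 * k)
    {W : Matrix (Fin n) (Fin n) ℝ} (hW : W.IsHermitian)
    (hWd : ∀ i j, |W i j - (1 : Matrix (Fin n) (Fin n) ℝ) i j| ≤ pertSize n)
    {e : Fin n → ℝ} (he : e ⬝ᵥ e = 1) {g : ℝ} (hg : g = 2 - 1 / (n + 1)) {c : ℝ} (hc : 0 < c)
    {N M : Matrix (Fin n) (Fin n) ℝ} (hN : N.PosSemidef)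
    (hM : M = c • (1 - g • vecMulVec e e) - N) (hherm : (W * M * W).IsHermitian) :
    eigenvals (W * M * W) ∉ Gam n k := by
  intro hmem
  have hn : 1 ≤ n := by omega
  have h0 := quadForm_lower_bound_of_mem_Gam hkn hk hherm hmem e
  have hWT : Wᵀ = W := by
    rw [← conjTranspose_eq_transpose_of_trivial]; exact hW
  -- N enters M with a minus sign, so it can only decrease both the quadratic form and the trace.
  have hWNW : (W * N * W).PosSemidef := by
    have := hN.mul_mul_conjTranspose_same W
    rwa [hW.eq] at this
  have hq := hWNW.dotProduct_mulVec_nonneg e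
  have ht := hWNW.trace_nonneg
  have key := quadForm_pert_neg hn hWd he hg
  have hsplit : W * M * W = c • (W * W - g • vecMulVec (W *ᵥ e) (W *ᵥ e)) - W * N * W := by
    rw [hM]
    have : W * vecMulVec e e * W = vecMulVec (W *ᵥ e) (W *ᵥ e) := by
      rw [mul_vecMulVec, vecMulVec_mul]
      congr 1
      conv_lhs => rw [← hWT]
      exact vecMul_transpose W e
    rw [mul_sub, sub_mul, Matrix.mul_smul, Matrix.smul_mul, mul_sub, sub_mul, mul_one,
      Matrix.mul_smul, Matrix.smul_mul, this]
  have hee : e ⬝ᵥ ((W * W) *ᵥ e) = (W *ᵥ e) ⬝ᵥ (W *ᵥ e) := by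
    rw [← mulVec_mulVec, dotProduct_mulVec]
    congr 1
    conv_lhs => rw [← hWT]
    exact vecMul_transpose W e
  have hev : e ⬝ᵥ (vecMulVec (W *ᵥ e) (W *ᵥ e) *ᵥ e) = (e ⬝ᵥ (W *ᵥ e)) ^ 2 := by
    rw [vecMulVec_mulVec, dotProduct_comm (W *ᵥ e) e]
    simp [dotProduct_smul]
    ring
  rw [hsplit] at h0
  simp only [sub_mulVec, smul_mulVec, dotProduct_sub, dotProduct_smul, smul_eq_mul, hee, hev,
    trace_sub, trace_smul, trace_vecMulVec, he, mul_one] at h0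
  simp only [star_trivial] at hq
  nlinarith [mul_neg_of_pos_of_neg hc key]

/-- Every symmetric matrix is bounded above by a positive multiple of the identity. -/
theorem exists_smul_one_sub_posSemidef {n : ℕ} {F : Matrix (Fin n) (Fin n) ℝ}
    (hF : F.IsHermitian) :
    ∃ L : ℝ, 0 < L ∧ (L • (1 : Matrix (Fin n) (Fin n) ℝ) - F).PosSemidef := by
  obtain ⟨L, hL⟩ : ∃ L : ℝ, ∀ i, hF.eigenvalues i ≤ L := by
    obtain ⟨L, hL⟩ := (Set.finite_range hF.eigenvalues).bddAbove
    exact ⟨L, fun i => hL ⟨i, rfl⟩⟩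
  have hF' : (-F).IsHermitian := hF.neg
  obtain ⟨L', hL'⟩ : ∃ L : ℝ, ∀ i, -hF'.eigenvalues i ≤ L := by
    obtain ⟨L, hL⟩ := (Set.finite_range (-hF'.eigenvalues)).bddAbove
    exact ⟨L, fun i => hL ⟨i, rfl⟩⟩
  refine ⟨max L' 1, by positivity, PosSemidef.of_dotProduct_mulVec_nonneg ?_ fun x => ?_⟩
  · exact (isHermitian_one.smul (by simp [IsSelfAdjoint])).sub hF
  · have := neg_mul_dotProduct_le_of_eigenvalues hF' (c := max L' 1)
      (fun i => by have := hL' i; have := le_max_left L' 1; linarith) x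
    simp [sub_mulVec, smul_mulVec, dotProduct_sub, neg_mulVec] at this ⊢
    linarith

end Matrices

/-! ### Hessians of sums and radial functions. -/

section Hessian

open scoped RealInnerProductSpace

variable {n : ℕ}

theorem hess_apply {φ : EuclideanSpace ℝ (Fin n) → ℝ} {x : EuclideanSpace ℝ (Fin n)}
    (h : ContDiffAt ℝ 2 φ x) (i j : Fin n) :
    hess φ x i j = fderiv ℝ (fderiv ℝ φ) x (EuclideanSpace.single i 1)
      (EuclideanSpace.single j 1) := by
  have hd : DifferentiableAt ℝ (fderiv ℝ φ) x :=
    (h.fderiv_right (m := 1) (by norm_num)).differentiableAt (by norm_num)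
  simp only [hess, Matrix.of_apply]
  rw [fderiv_clm_apply hd (differentiableAt_const _)]
  simp

theorem hess_add {φ ψ : EuclideanSpace ℝ (Fin n) → ℝ} {x : EuclideanSpace ℝ (Fin n)}
    (hφ : ContDiffAt ℝ 2 φ x) (hψ : ContDiffAt ℝ 2 ψ x) :
    hess (fun z => φ z + ψ z) x = hess φ x + hess ψ x := by
  ext i j
  have hd : ∀ {f : EuclideanSpace ℝ (Fin n) → ℝ}, ContDiffAt ℝ 2 f x →
      DifferentiableAt ℝ (fderiv ℝ f) x := fun h =>
    (h.fderiv_right (m := 1) (by norm_num)).differentiableAt (by norm_num)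
  have hev : ∀ {f : EuclideanSpace ℝ (Fin n) → ℝ}, ContDiffAt ℝ 2 f x →
      ∀ᶠ z in 𝓝 x, DifferentiableAt ℝ f z := fun h =>
    (h.eventually (by simp)).mono fun z hz => hz.differentiableAt (by norm_num)
  have hev2 : fderiv ℝ (fun z => φ z + ψ z) =ᶠ[𝓝 x] fun z => fderiv ℝ φ z + fderiv ℝ ψ z := by
    filter_upwards [hev hφ, hev hψ] with z h1 h2
    exact fderiv_fun_add h1 h2
  rw [Matrix.add_apply, hess_apply hφ, hess_apply hψ, hess_apply (hφ.add hψ), hev2.fderiv_eq,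
    fderiv_fun_add (hd hφ) (hd hψ)]
  simp

/-- The profile is taken as a function of the squared distance, whose derivative is explicit; only s
> 0 is required because the cusp profile is singular at 0. -/
theorem hess_radial {f f1 : ℝ → ℝ} {f2 : ℝ} {x y : EuclideanSpace ℝ (Fin n)} (hxy : x ≠ y)
    (hf : ∀ s > 0, HasDerivAt f (f1 s) s) (hf1 : HasDerivAt f1 f2 (‖x - y‖ ^ 2)) :
    hess (fun z => f (‖z - y‖ ^ 2)) x =
      (2 * f1 (‖x - y‖ ^ 2)) • (1 : Matrix (Fin n) (Fin n) ℝ) +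
        (4 * f2) • Matrix.vecMulVec (x - y).ofLp (x - y).ofLp := by
  have hs : ∀ z : EuclideanSpace ℝ (Fin n),
      HasFDerivAt (fun z => ‖z - y‖ ^ 2) (2 • (innerSL ℝ (z - y))) z := by
    intro z
    have := ((hasFDerivAt_id (𝕜 := ℝ) z).sub_const y).norm_sq
    simpa using this
  have hpos : ∀ z : EuclideanSpace ℝ (Fin n), z ≠ y → 0 < ‖z - y‖ ^ 2 := fun z hz => by
    have := norm_pos_iff.2 (sub_ne_zero.2 hz)
    positivity
  ext i j
  have hev : (fun z => fderiv ℝ (fun z => f (‖z - y‖ ^ 2)) z (EuclideanSpace.single j (1 : ℝ)))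
      =ᶠ[𝓝 x] fun z => 2 * (f1 (‖z - y‖ ^ 2) * (z - y) j) := by
    filter_upwards [isOpen_ne.mem_nhds hxy] with z hz
    have hz' : HasFDerivAt (fun z => f (‖z - y‖ ^ 2)) _ z :=
      (hf _ (hpos z hz)).comp_hasFDerivAt z (hs z)
    rw [hz'.fderiv]
    simp [EuclideanSpace.inner_single_right]
    ring
  have hcoord : HasFDerivAt (fun z : EuclideanSpace ℝ (Fin n) => (z - y) j)
      (EuclideanSpace.proj j : EuclideanSpace ℝ (Fin n) →L[ℝ] ℝ) x := by
    have := ((EuclideanSpace.proj j : EuclideanSpace ℝ (Fin n) →L[ℝ] ℝ).hasFDerivAt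
      (x := x)).sub_const (y j)
    exact this
  have hmain : HasFDerivAt (fun z => 2 * (f1 (‖z - y‖ ^ 2) * (z - y) j)) _ x :=
    ((hf1.comp_hasFDerivAt x (hs x)).mul hcoord).const_mul 2
  simp only [hess, Matrix.of_apply]
  rw [hev.fderiv_eq, hmain.fderiv]
  by_cases hij : i = j
  · subst hij
    simp [EuclideanSpace.inner_single_right, Matrix.vecMulVec_apply]
    ring
  · simp [EuclideanSpace.inner_single_right, Matrix.vecMulVec_apply, hij]
    ring

end Hessian

/-! ### Comparison with cusps. -/

section Barrier

variable {n k : ℕ} {W : EuclideanSpace ℝ (Fin n) → Matrix (Fin n) (Fin n) ℝ}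
  {w Q : EuclideanSpace ℝ (Fin n) → ℝ}

/-- Exponent of the cusp barrier. -/
noncomputable def cuspExp (n : ℕ) : ℝ := 1 / (2 * (n + 1))

theorem cuspExp_pos (n : ℕ) : 0 < cuspExp n := by unfold cuspExp; positivity

/-- A viscosity subsolution, corrected by a quadratic function, lies below a cusp barrier. -/
theorem le_cusp_barrier (hkn : k ≤ n) (hk : n < 2 * k)
    (hW : ∀ x ∈ Metric.ball (0 : EuclideanSpace ℝ (Fin n)) 1, (W x).IsHermitian)
    (hWd : ∀ x ∈ Metric.ball (0 : EuclideanSpace ℝ (Fin n)) 1, ∀ i j,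
      |W x i j - (1 : Matrix (Fin n) (Fin n) ℝ) i j| ≤ pertSize n)
    (hw : IsViscositySubsolution k W w) (hQ : ContDiff ℝ 2 Q)
    {F : Matrix (Fin n) (Fin n) ℝ} (hQF : ∀ x, hess Q x = F) {L : ℝ}
    (hL : (L • (1 : Matrix (Fin n) (Fin n) ℝ) - F).PosSemidef)
    {y : EuclideanSpace ℝ (Fin n)} {ρ : ℝ} (hρ : 0 < ρ)
    (hsub : Metric.closedBall y ρ ⊆ Metric.ball 0 1) {K : ℝ} (hK : 0 < K)
    (hbd : ∀ x, ‖x - y‖ = ρ → w x - Q x + L / 2 * ρ ^ 2 ≤ w y - Q y + K)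
    {x : EuclideanSpace ℝ (Fin n)} (hx : x ∈ Metric.closedBall y ρ) :
    w x - Q x + L / 2 * ‖x - y‖ ^ 2 ≤ w y - Q y + K * (‖x - y‖ ^ 2 / ρ ^ 2) ^ cuspExp n := by
  have hβ := cuspExp_pos n
  set β := cuspExp n with hβdef
  -- β acts on the squared distance, so the cusp has exponent 2β = 1/(n+1) in the distance and g = 2
  -- - 2β.
  have hβn : β = 1 / (2 * (n + 1)) := rfl
  set f : ℝ → ℝ := fun s => K * (s / ρ ^ 2) ^ β - L / 2 * s with hf
  set h : EuclideanSpace ℝ (Fin n) → ℝ := fun x => w x - Q x - f (‖x - y‖ ^ 2) with hh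
  have hfc : Continuous f := by
    refine (continuous_const.mul ?_).sub (by fun_prop)
    exact (continuous_id.div_const _).rpow_const fun _ => Or.inr hβ.le
  have hhc : ContinuousOn h (Metric.closedBall y ρ) := by
    refine ((hw.1.mono hsub).sub hQ.continuous.continuousOn).sub (Continuous.continuousOn ?_)
    exact hfc.comp (by fun_prop)
  have hhy : h y = w y - Q y := by
    simp [hh, hf, Real.zero_rpow hβ.ne']
  obtain ⟨x₁, hx₁, hmax⟩ := (isCompact_closedBall y ρ).exists_isMaxOn
    ⟨y, Metric.mem_closedBall_self hρ.le⟩ hhc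
  rcases le_or_gt (h x₁) (h y) with hle | hgt
  · have h1 : h x ≤ h y := (hmax hx).trans hle
    rw [hhy] at h1
    simp only [hh, hf] at h1
    linarith
  -- If the maximum of `h` exceeds its value at the vertex, it is attained away from y, and `hbd`
  -- keeps it off the sphere. A smooth cusp branch then touches w from above at x₁.
  exfalso
  have hne : x₁ ≠ y := by rintro rfl; exact lt_irrefl _ hgt
  have hpos : 0 < ‖x₁ - y‖ := norm_pos_iff.2 (sub_ne_zero.2 hne)
  have hlt : ‖x₁ - y‖ < ρ := by
    have h1 : ‖x₁ - y‖ ≤ ρ := by simpa [dist_eq_norm] using hx₁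
    refine lt_of_le_of_ne h1 fun heq => ?_
    have h2 := hbd x₁ heq
    rw [hhy] at hgt
    simp only [hh, hf, heq] at hgt
    rw [div_self (by positivity), Real.one_rpow] at hgt
    linarith
  set U : Set (EuclideanSpace ℝ (Fin n)) := Metric.ball y ρ ∩ {y}ᶜ with hU
  have hUo : IsOpen U := Metric.isOpen_ball.inter isOpen_compl_singleton
  have hxU : x₁ ∈ U := ⟨by simpa [dist_eq_norm] using hlt, hne⟩
  have hUsub : U ⊆ Metric.closedBall y ρ := fun z hz => Metric.ball_subset_closedBall hz.1
  set φ : EuclideanSpace ℝ (Fin n) → ℝ := fun z => f (‖z - y‖ ^ 2) + (Q z + h x₁) with hφ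
  have hfs : ∀ s > 0, ContDiffAt ℝ 2 f s := by
    intro s hs
    refine (contDiffAt_const.mul ?_).sub (by fun_prop)
    refine ContDiffAt.rpow_const_of_ne (by fun_prop) ?_
    positivity
  have hcusp : ∀ z, z ≠ y → ContDiffAt ℝ 2 (fun z => f (‖z - y‖ ^ 2)) z := by
    intro z hz
    have : 0 < ‖z - y‖ := norm_pos_iff.2 (sub_ne_zero.2 hz)
    exact ContDiffAt.comp z (hfs _ (by positivity))
      ((contDiffAt_id.sub contDiffAt_const).norm_sq ℝ)
  have hQc : ContDiff ℝ 2 (fun z => Q z + h x₁) := hQ.add contDiff_const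
  have hφU : ContDiffOn ℝ 2 φ U := fun z hz =>
    ((hcusp z hz.2).add hQc.contDiffAt).contDiffWithinAt
  have hvis := (hw.2 x₁ (hsub hx₁) U hUo hxU (hUsub.trans hsub) φ hφU
    (by simp only [hφ, hh]; ring) (fun z hz => by
      have h1 : h z ≤ h x₁ := hmax (hUsub hz)
      simp only [hφ]; simp only [hh] at h1 ⊢; linarith)).2
  have hherm := isHermitian_conj_hess (hW x₁ (hsub hx₁)) hUo hφU hxU
  set s := ‖x₁ - y‖ ^ 2 with hs
  have hs0 : 0 < s := by positivity
  have hρ2 : 0 < ρ ^ 2 := by positivity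
  set f1 : ℝ → ℝ := fun t => K * β * (t / ρ ^ 2) ^ (β - 1) / ρ ^ 2 - L / 2 with hf1
  have hd1 : ∀ t > 0, HasDerivAt f (f1 t) t := by
    intro t ht
    have h1 : HasDerivAt (fun t : ℝ => t / ρ ^ 2) (1 / ρ ^ 2) t := (hasDerivAt_id t).div_const _
    have h2 := ((h1.rpow_const (p := β) (Or.inl (by positivity))).const_mul K).sub
      ((hasDerivAt_id t).const_mul (L / 2))
    exact h2.congr_deriv (by simp only [hf1]; ring)
  have hd2 : HasDerivAt f1 (K * β * (β - 1) * (s / ρ ^ 2) ^ (β - 1) / ρ ^ 2 / s) s := by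
    have h1 : HasDerivAt (fun t : ℝ => t / ρ ^ 2) (1 / ρ ^ 2) s := (hasDerivAt_id s).div_const _
    have h2 := (((h1.rpow_const (p := β - 1) (Or.inl (by positivity))).const_mul
      (K * β)).div_const (ρ ^ 2)).sub_const (L / 2)
    refine h2.congr_deriv ?_
    rw [Real.rpow_sub_one (by positivity) (β - 1)]
    field_simp
  have hhess : hess φ x₁ =
      (2 * f1 s) • (1 : Matrix (Fin n) (Fin n) ℝ) +
        (4 * (K * β * (β - 1) * (s / ρ ^ 2) ^ (β - 1) / ρ ^ 2 / s)) •
          Matrix.vecMulVec (x₁ - y).ofLp (x₁ - y).ofLp + F := by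
    rw [hφ, hess_add (hcusp x₁ hne) hQc.contDiffAt, hess_radial hne hd1 hd2,
      hess_add hQ.contDiffAt contDiffAt_const, hQF]
    congr 1
    ext i j
    simp [hess]
  set c : ℝ := 2 * (K * β * (s / ρ ^ 2) ^ (β - 1) / ρ ^ 2) with hc
  have hc0 : 0 < c := by positivity
  set e : Fin n → ℝ := ‖x₁ - y‖⁻¹ • (x₁ - y).ofLp with he
  have hee : e ⬝ᵥ e = 1 := by
    have h1 : (x₁ - y).ofLp ⬝ᵥ (x₁ - y).ofLp = s := by
      rw [hs, EuclideanSpace.norm_sq_eq]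
      simp [dotProduct, sq]
    rw [he, smul_dotProduct, dotProduct_smul, h1, hs]
    simp only [smul_eq_mul]
    field_simp
  have hve : Matrix.vecMulVec e e = s⁻¹ • Matrix.vecMulVec (x₁ - y).ofLp (x₁ - y).ofLp := by
    rw [he, Matrix.smul_vecMulVec, Matrix.vecMulVec_smul, smul_smul, hs]
    congr 1
    field_simp
  -- The term -L/2·|x - y|² in the barrier absorbs D²Q: what remains beside the cusp Hessian is
  -- -(L·I - F) ≤ 0.
  have hM : hess φ x₁ = c • (1 - (2 - 1 / ((n : ℝ) + 1)) • Matrix.vecMulVec e e) -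
      (L • (1 : Matrix (Fin n) (Fin n) ℝ) - F) := by
    have hg : (2 - 1 / ((n : ℝ) + 1)) = -2 * (β - 1) := by rw [hβn]; field_simp; ring
    rw [hhess, hve, hg, smul_sub, smul_smul, smul_smul]
    have e1 : 2 * f1 s = c - L := by simp only [hf1, hc]; ring
    have e2 : 4 * (K * β * (β - 1) * (s / ρ ^ 2) ^ (β - 1) / ρ ^ 2 / s) =
        -(c * (-2 * (β - 1)) * s⁻¹) := by rw [hc]; ring
    rw [e1, e2, sub_smul, neg_smul, mul_assoc]
    abel
  exact eigenvals_cusp_notMem_Gam hkn hk (hW x₁ (hsub hx₁)) (hWd x₁ (hsub hx₁)) hee rfl hc0 hL hM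
    hherm hvis

end Barrier

/-! ### Small weak Hessian and small oscillation give affine approximation. -/

section Mollification

variable {n : ℕ}

theorem hasFDerivAt_integral_mul_sub {g f : EuclideanSpace ℝ (Fin n) → ℝ}
    (hg : Integrable g) (hf : ContDiff ℝ ∞ f) (hfc : HasCompactSupport f)
    (x : EuclideanSpace ℝ (Fin n)) :
    ∃ D : EuclideanSpace ℝ (Fin n) →L[ℝ] ℝ,
      HasFDerivAt (fun x => ∫ t, g t * f (x - t)) D x ∧
        ∀ v, D v = ∫ t, g t * fderiv ℝ f (x - t) v := by
  have hf1 : ContDiff ℝ 1 f := hf.of_le (by exact_mod_cast le_top)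
  have h := hfc.hasFDerivAt_convolution_right (ContinuousLinearMap.lsmul ℝ ℝ)
    hg.locallyIntegrable hf1 x (μ := volume)
  refine ⟨_, h, fun v => ?_⟩
  rw [convolution_def, ContinuousLinearMap.integral_apply]
  · rfl
  · exact (hfc.fderiv ℝ).convolutionExists_right _ hg.locallyIntegrable
      (hf1.continuous_fderiv one_ne_zero) x

theorem fderiv_integral_mul_sub {g f : EuclideanSpace ℝ (Fin n) → ℝ}
    (hg : Integrable g) (hf : ContDiff ℝ ∞ f) (hfc : HasCompactSupport f)
    (x v : EuclideanSpace ℝ (Fin n)) :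
    fderiv ℝ (fun x => ∫ t, g t * f (x - t)) x v = ∫ t, g t * fderiv ℝ f (x - t) v := by
  obtain ⟨D, hD, h⟩ := hasFDerivAt_integral_mul_sub hg hf hfc x
  rw [hD.fderiv, h]

/-- Both derivatives fall on the kernel, which turns the Hessian of a mollification into the
distributional Hessian tested against a translate of the kernel. -/
theorem hess_integral_mul_sub {g f : EuclideanSpace ℝ (Fin n) → ℝ}
    (hg : Integrable g) (hf : ContDiff ℝ ∞ f) (hfc : HasCompactSupport f)
    (x : EuclideanSpace ℝ (Fin n)) (i j : Fin n) :
    hess (fun x => ∫ t, g t * f (x - t)) x i j = ∫ t, g t * hess f (x - t) i j := by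
  simp only [hess, Matrix.of_apply]
  simp_rw [fderiv_integral_mul_sub hg hf hfc]
  have h1 : ContDiff ℝ ∞ (fun y => fderiv ℝ f y (EuclideanSpace.single j (1 : ℝ))) :=
    (hf.fderiv_right (m := ∞) (by simp)).clm_apply contDiff_const
  have h2 : HasCompactSupport (fun y => fderiv ℝ f y (EuclideanSpace.single j (1 : ℝ))) :=
    hfc.fderiv_apply ℝ _
  exact fderiv_integral_mul_sub hg h1 h2 x _

theorem fderiv_comp_const_sub' {f : EuclideanSpace ℝ (Fin n) → ℝ} (hf : Differentiable ℝ f)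
    (x t v : EuclideanSpace ℝ (Fin n)) :
    fderiv ℝ (fun t => f (x - t)) t v = -fderiv ℝ f (x - t) v := by
  have h1 : HasFDerivAt (fun t : EuclideanSpace ℝ (Fin n) => x - t)
      (-ContinuousLinearMap.id ℝ _) t := (hasFDerivAt_id t).const_sub x
  have h2 : HasFDerivAt (fun t => f (x - t)) _ t := (hf (x - t)).hasFDerivAt.comp t h1
  rw [h2.fderiv]
  simp

theorem hess_comp_const_sub {f : EuclideanSpace ℝ (Fin n) → ℝ} (hf : ContDiff ℝ ∞ f)
    (x t : EuclideanSpace ℝ (Fin n)) (i j : Fin n) :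
    hess (fun t => f (x - t)) t i j = hess f (x - t) i j := by
  have h1 : ContDiff ℝ ∞ (fun y => fderiv ℝ f y (EuclideanSpace.single j (1 : ℝ))) :=
    (hf.fderiv_right (m := ∞) (by simp)).clm_apply contDiff_const
  simp only [hess, Matrix.of_apply]
  simp_rw [fderiv_comp_const_sub' (hf.differentiable (by simp))]
  have h2 := fderiv_comp_const_sub' (h1.differentiable (by simp)) x t (EuclideanSpace.single i 1)
  rw [fderiv_fun_neg, neg_apply, h2, neg_neg]

theorem norm_le_of_entries_le
    {T : EuclideanSpace ℝ (Fin n) →L[ℝ] EuclideanSpace ℝ (Fin n) →L[ℝ] ℝ}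
    {H : ℝ} (hH : 0 ≤ H)
    (h : ∀ i j, |T (EuclideanSpace.single i 1) (EuclideanSpace.single j 1)| ≤ H) :
    ‖T‖ ≤ n ^ 2 * H := by
  have hsum : ∀ v : EuclideanSpace ℝ (Fin n), v = ∑ i, v i • EuclideanSpace.single i (1 : ℝ) := by
    intro v
    ext j
    simp [Finset.sum_apply, Pi.single_apply]
  have hco : ∀ (v : EuclideanSpace ℝ (Fin n)) i, |v i| ≤ ‖v‖ := fun v i => by
    simpa using PiLp.norm_apply_le v i
  refine ContinuousLinearMap.opNorm_le_bound _ (by positivity) fun u => ?_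
  refine ContinuousLinearMap.opNorm_le_bound _ (by positivity) fun v => ?_
  conv_lhs => rw [hsum u, hsum v]
  simp only [map_sum, map_smul, sum_apply, smul_apply,
    smul_eq_mul]
  calc ‖∑ j, v j * ∑ i, u i * T (EuclideanSpace.single i 1) (EuclideanSpace.single j 1)‖
      ≤ ∑ j : Fin n, ‖v‖ * ∑ i : Fin n, ‖u‖ * H := by
        refine (norm_sum_le _ _).trans (Finset.sum_le_sum fun j _ => ?_)
        rw [norm_mul]
        refine mul_le_mul (hco v j) ?_ (norm_nonneg _) (norm_nonneg _)
        refine (norm_sum_le _ _).trans (Finset.sum_le_sum fun i _ => ?_)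
        rw [norm_mul]
        exact mul_le_mul (hco u i) (h i j) (norm_nonneg _) (norm_nonneg _)
    _ = n ^ 2 * H * ‖u‖ * ‖v‖ := by simp; ring

/-- A `C²` function with small Hessian is close to an affine function. -/
theorem abs_sub_affine_le_of_hess_le {G : EuclideanSpace ℝ (Fin n) → ℝ} (hG : ContDiff ℝ 2 G)
    {x₀ : EuclideanSpace ℝ (Fin n)} {s H : ℝ} (hs : 0 < s) (hH : 0 ≤ H)
    (h : ∀ x ∈ Metric.ball x₀ s, ∀ i j, |hess G x i j| ≤ H) {y : EuclideanSpace ℝ (Fin n)}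
    (hy : y ∈ Metric.ball x₀ s) :
    |G y - G x₀ - fderiv ℝ G x₀ (y - x₀)| ≤ n ^ 2 * H * s ^ 2 := by
  have hx₀ : x₀ ∈ Metric.ball x₀ s := Metric.mem_ball_self hs
  have hconv := convex_ball x₀ s
  have hG1 : ContDiff ℝ 1 (fderiv ℝ G) := hG.fderiv_right (by norm_num)
  have hnorm : ∀ x ∈ Metric.ball x₀ s, ‖x - x₀‖ ≤ s := fun x hx => by
    rw [← dist_eq_norm]; exact (Metric.mem_ball.1 hx).le
  have h1 : ∀ x ∈ Metric.ball x₀ s, ‖fderiv ℝ G x - fderiv ℝ G x₀‖ ≤ n ^ 2 * H * s := by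
    intro x hx
    have := hconv.norm_image_sub_le_of_norm_fderiv_le (𝕜 := ℝ) (C := n ^ 2 * H)
      (fun z _ => (hG1.differentiable (by norm_num)) z)
      (fun z hz => norm_le_of_entries_le hH fun i j => by
        rw [← hess_apply hG.contDiffAt]; exact h z hz i j) hx₀ hx
    refine this.trans ?_
    gcongr
    exact hnorm x hx
  have h2 := hconv.norm_image_sub_le_of_norm_hasFDerivWithin_le' (𝕜 := ℝ) (f := G)
    (fun x _ => ((hG.differentiable (by norm_num)) x).hasFDerivAt.hasFDerivWithinAt) h1 hx₀ hy
  rw [Real.norm_eq_abs] at h2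
  refine h2.trans ?_
  calc n ^ 2 * H * s * ‖y - x₀‖ ≤ n ^ 2 * H * s * s := by gcongr; exact hnorm y hy
    _ = n ^ 2 * H * s ^ 2 := by ring

/-- If the distributional Hessian of `v` is small on a ball and `v` oscillates little at scale `τ`,
then `v` is close to an affine function. -/
theorem exists_affine_of_weak_hess_le {v : EuclideanSpace ℝ (Fin n) → ℝ}
    {x₀ : EuclideanSpace ℝ (Fin n)} {r τ θ κ : ℝ} (hτ : 0 < τ) (hτr : 4 * τ ≤ r) (hθ : 0 ≤ θ)
    (hv : IntegrableOn v (Metric.ball x₀ r))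
    (hweak : ∀ i j, ∀ φ : EuclideanSpace ℝ (Fin n) → ℝ, ContDiff ℝ ∞ φ → HasCompactSupport φ →
      tsupport φ ⊆ Metric.ball x₀ r → ∀ C, (∀ x, |φ x| ≤ C) →
        |∫ x in Metric.ball x₀ r, v x * hess φ x i j| ≤ θ * C)
    (hosc : ∀ y ∈ Metric.ball x₀ (r / 4), ∀ z, ‖z - y‖ < τ → |v z - v y| ≤ κ) :
    ∃ (a : ℝ) (b : EuclideanSpace ℝ (Fin n) →L[ℝ] ℝ), ∀ y ∈ Metric.ball x₀ (r / 4),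
      |v y - (a + b (y - x₀))| ≤ κ + n ^ 2 *
        (θ * (1 / volume.real (Metric.closedBall (0 : EuclideanSpace ℝ (Fin n)) (τ / 2)))) *
          (r / 4) ^ 2 := by
  let ρ : ContDiffBump (0 : EuclideanSpace ℝ (Fin n)) := ⟨τ / 2, τ, by positivity, by linarith⟩
  set f : EuclideanSpace ℝ (Fin n) → ℝ := ρ.normed volume with hf
  have hfd : ContDiff ℝ ∞ f := ρ.contDiff_normed
  have hfc : HasCompactSupport f := ρ.hasCompactSupport_normed
  set g : EuclideanSpace ℝ (Fin n) → ℝ := (Metric.ball x₀ r).indicator v with hg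
  have hgi : Integrable g := (integrable_indicator_iff Metric.isOpen_ball.measurableSet).2 hv
  have hgv : ∀ z ∈ Metric.ball x₀ r, g z = v z := fun z hz => Set.indicator_of_mem hz v
  set G : EuclideanSpace ℝ (Fin n) → ℝ := fun x => ∫ t, g t * f (x - t) with hG
  have hGd : ContDiff ℝ 2 G := by
    have : ContDiff ℝ (2 : ℕ∞) G :=
      hfc.contDiff_convolution_right (ContinuousLinearMap.lsmul ℝ ℝ)
        hgi.locallyIntegrable (hfd.of_le (by exact_mod_cast le_top))
    exact_mod_cast this
  set S : ℝ := 1 / volume.real (Metric.closedBall (0 : EuclideanSpace ℝ (Fin n)) (τ / 2)) with hS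
  have hS0 : 0 ≤ S := by positivity
  -- The supremum of the normalised bump is the factor lost in turning the weak bound θ into a
  -- pointwise Hessian bound.
  have hfS : ∀ x, |f x| ≤ S := fun x => by
    rw [abs_of_nonneg (ρ.nonneg_normed x)]
    exact ρ.normed_le_div_measure_closedBall_rIn volume x
  have hsubτ : ∀ x ∈ Metric.ball x₀ (r / 4), Metric.closedBall x τ ⊆ Metric.ball x₀ r := by
    intro x hx z hz
    rw [Metric.mem_ball] at hx ⊢
    rw [Metric.mem_closedBall] at hz
    have := dist_triangle z x x₀
    linarith
  have hhess : ∀ x ∈ Metric.ball x₀ (r / 4), ∀ i j, |hess G x i j| ≤ θ * S := by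
    intro x hx i j
    rw [hG, hess_integral_mul_sub hgi hfd hfc]
    have e1 : ∫ t, g t * hess f (x - t) i j =
        ∫ t in Metric.ball x₀ r, v t * hess (fun t => f (x - t)) t i j := by
      rw [← integral_indicator Metric.isOpen_ball.measurableSet]
      refine integral_congr_ae (Eventually.of_forall fun t => ?_)
      simp only [hess_comp_const_sub hfd, hg]
      by_cases ht : t ∈ Metric.ball x₀ r <;> simp [ht]
    have hsupp : tsupport (fun t => f (x - t)) ⊆ Metric.closedBall x τ := by
      refine closure_minimal (fun t ht => ?_) Metric.isClosed_closedBall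
      have h1 : x - t ∈ Function.support f := ht
      rw [hf, ρ.support_normed_eq] at h1
      rw [Metric.mem_closedBall, dist_comm, dist_eq_norm]
      have h2 : ‖x - t‖ < τ := by simpa using h1
      exact h2.le
    rw [e1]
    refine hweak i j _ ?_ ?_ (hsupp.trans (hsubτ x hx)) S fun t => hfS _
    · exact hfd.comp (contDiff_const.sub contDiff_id)
    · exact HasCompactSupport.of_support_subset_isCompact (isCompact_closedBall x τ)
        (subset_closure.trans hsupp)
  refine ⟨G x₀, fderiv ℝ G x₀, fun y hy => ?_⟩
  have h1 := abs_sub_affine_le_of_hess_le hGd (by linarith) (mul_nonneg hθ hS0) hhess hy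
  have h2 : |G y - v y| ≤ κ := by
    have h3 := ρ.dist_normed_convolution_le (μ := volume) (x₀ := y) (g := g) (ε := κ)
      hgi.aestronglyMeasurable (fun z hz => by
        rw [hgv y (hsubτ y hy (Metric.mem_closedBall_self hτ.le)),
          hgv z (hsubτ y hy (Metric.ball_subset_closedBall hz)), Real.dist_eq]
        exact hosc y hy z (by simpa [dist_eq_norm] using hz))
    rw [convolution_lsmul_swap, hgv y (hsubτ y hy (Metric.mem_closedBall_self hτ.le)),
      Real.dist_eq] at h3
    simpa [hG, hf, mul_comm] using h3
  calc |v y - (G x₀ + fderiv ℝ G x₀ (y - x₀))|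
      = |-(G y - v y) + (G y - G x₀ - fderiv ℝ G x₀ (y - x₀))| := by congr 1; ring
    _ ≤ |-(G y - v y)| + |G y - G x₀ - fderiv ℝ G x₀ (y - x₀)| := abs_add_le _ _
    _ ≤ _ := by rw [abs_neg]; exact add_le_add h2 h1

end Mollification

/-! ### Differentiation of measures and the approximate Hessian. -/

section Differentiation

variable {n : ℕ}

/-- Almost everywhere, a finite measure is approximated on small balls by its density times
Lebesgue measure, in total variation. -/
theorem ae_integral_sub_rnDeriv_le (μ : Measure (EuclideanSpace ℝ (Fin n))) [IsFiniteMeasure μ] :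
    ∀ᵐ x₀ : EuclideanSpace ℝ (Fin n), ∀ ε > 0, ∀ᶠ r in 𝓝[>] (0 : ℝ),
      ∀ φ : EuclideanSpace ℝ (Fin n) → ℝ, Continuous φ → HasCompactSupport φ →
        tsupport φ ⊆ Metric.ball x₀ r → ∀ C, (∀ x, |φ x| ≤ C) →
          |∫ x, φ x ∂μ - (μ.rnDeriv volume x₀).toReal * ∫ x, φ x| ≤
            ε * volume.real (Metric.closedBall x₀ r) * C := by
  set d : EuclideanSpace ℝ (Fin n) → ℝ := fun x => (μ.rnDeriv volume x).toReal with hd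
  have hdi : Integrable d := Measure.integrable_toReal_rnDeriv
  let V := Besicovitch.vitaliFamily (volume : Measure (EuclideanSpace ℝ (Fin n)))
  -- Almost every point has zero density for the singular part and is an L¹ Lebesgue point of the
  -- density. Both facts bound measures of balls, so the estimate is uniform in φ.
  have h1 := V.ae_eventually_measure_zero_of_singular
    (μ.mutuallySingular_singularPart volume)
  have h2 := V.ae_tendsto_average_norm_sub hdi.locallyIntegrable
  filter_upwards [h1, h2] with x₀ hs hl ε hε
  have hs' := hs.comp (Besicovitch.tendsto_filterAt volume x₀)
  have hl' := hl.comp (Besicovitch.tendsto_filterAt volume x₀)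
  have hε2 : 0 < ε / 2 := by positivity
  filter_upwards [hs'.eventually_lt_const (ENNReal.ofReal_pos.2 hε2), hl'.eventually_lt_const hε2,
    self_mem_nhdsWithin] with r hr1 hr2 hr φ hφ hφc hφs C hC
  replace hr : 0 < r := hr
  simp only [Function.comp] at hr1 hr2
  set B := Metric.closedBall x₀ r with hB
  have hC0 : 0 ≤ C := (abs_nonneg _).trans (hC x₀)
  have hsB : ∀ x, x ∉ B → φ x = 0 := fun x hx =>
    image_eq_zero_of_notMem_tsupport fun h => hx (Metric.ball_subset_closedBall (hφs h))
  have hVpos : 0 < volume B := Metric.measure_closedBall_pos _ _ hr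
  have hVtop : volume B ≠ ⊤ := measure_closedBall_lt_top.ne
  have hVr : 0 < volume.real B := ENNReal.toReal_pos hVpos.ne' hVtop
  have hsing : (μ.singularPart volume).real B ≤ ε / 2 * volume.real B := by
    rw [ENNReal.div_lt_iff (Or.inl hVpos.ne') (Or.inl hVtop)] at hr1
    have := ENNReal.toReal_mono (ENNReal.mul_ne_top ENNReal.ofReal_ne_top hVtop) hr1.le
    rwa [ENNReal.toReal_mul, ENNReal.toReal_ofReal hε2.le] at this
  have hdens : ∫ y in B, ‖d y - d x₀‖ ≤ ε / 2 * volume.real B := by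
    rw [setAverage_eq, smul_eq_mul, inv_mul_lt_iff₀ hVr] at hr2
    linarith
  have hφint : ∀ ν : Measure (EuclideanSpace ℝ (Fin n)), IsFiniteMeasureOnCompacts ν →
      Integrable φ ν := fun ν _ => hφ.integrable_of_hasCompactSupport hφc
  have hsplit : ∫ x, φ x ∂μ = ∫ x, φ x ∂(μ.singularPart volume) + ∫ x, d x * φ x := by
    have e : ∫ x, φ x ∂(volume.withDensity (μ.rnDeriv volume)) = ∫ x, d x * φ x := by
      rw [integral_withDensity_eq_integral_toReal_smul (Measure.measurable_rnDeriv _ _)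
        (Measure.rnDeriv_lt_top _ _)]
      simp [hd]
    conv_lhs => rw [μ.haveLebesgueDecomposition_add volume]
    rw [integral_add_measure, e]
    · exact hφint _ inferInstance
    · have : IsFiniteMeasure (volume.withDensity (μ.rnDeriv volume)) :=
        isFiniteMeasure_of_le μ (Measure.withDensity_rnDeriv_le μ volume)
      exact hφint _ inferInstance
  have hdφ : Integrable fun x => d x * φ x :=
    hdi.mul_bdd (c := C) hφ.aestronglyMeasurable (Eventually.of_forall hC)
  have e1 : ∫ x, φ x ∂μ - d x₀ * ∫ x, φ x =
      ∫ x in B, φ x ∂(μ.singularPart volume) + ∫ x in B, (d x - d x₀) * φ x := by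
    rw [hsplit, setIntegral_eq_integral_of_forall_compl_eq_zero hsB,
      setIntegral_eq_integral_of_forall_compl_eq_zero (fun x hx => by rw [hsB x hx, mul_zero])]
    simp_rw [sub_mul]
    rw [integral_sub hdφ ((hφint volume inferInstance).const_mul _), integral_const_mul]
    ring
  have b1 : |∫ x in B, φ x ∂(μ.singularPart volume)| ≤ C * (μ.singularPart volume).real B :=
    norm_setIntegral_le_of_norm_le_const (f := φ) (measure_lt_top _ B) fun x _ => hC x
  have b2 : |∫ x in B, (d x - d x₀) * φ x| ≤ C * ∫ y in B, ‖d y - d x₀‖ := by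
    rw [← integral_const_mul, ← Real.norm_eq_abs]
    refine norm_integral_le_of_norm_le ?_ (Eventually.of_forall fun x => ?_)
    · exact ((hdi.integrableOn.sub (integrableOn_const hVtop)).norm).const_mul _
    · rw [norm_mul, mul_comm]
      exact mul_le_mul_of_nonneg_right (hC x) (norm_nonneg _)
  change |∫ x, φ x ∂μ - d x₀ * ∫ x, φ x| ≤ _
  rw [e1]
  refine (abs_add_le _ _).trans ((add_le_add b1 b2).trans ?_)
  have := mul_le_mul_of_nonneg_left hsing hC0
  have := mul_le_mul_of_nonneg_left hdens hC0
  linarith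

/-- Almost everywhere, a function whose second distributional derivatives are measures has an
approximate Hessian in the weak sense. -/
theorem ae_exists_weak_hess {w : EuclideanSpace ℝ (Fin n) → ℝ} (hw : SecondDerivsAreMeasures w) :
    ∀ᵐ x₀ : EuclideanSpace ℝ (Fin n), x₀ ∈ Metric.ball (0 : EuclideanSpace ℝ (Fin n)) 1 →
      ∃ F : Matrix (Fin n) (Fin n) ℝ, F.IsHermitian ∧ ∀ ε > 0, ∀ᶠ r in 𝓝[>] (0 : ℝ),
        ∀ i j, ∀ φ : EuclideanSpace ℝ (Fin n) → ℝ, ContDiff ℝ ∞ φ → HasCompactSupport φ →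
          tsupport φ ⊆ Metric.ball x₀ r → ∀ C, (∀ x, |φ x| ≤ C) →
            |(∫ x in Metric.ball 0 1, w x * hess φ x i j) - F i j * ∫ x, φ x| ≤
              ε * volume.real (Metric.closedBall x₀ r) * C := by
  obtain ⟨μp, μm, hsym, hfin, hint⟩ := hw
  -- The measures are finite only on compact subsets of the unit ball. Restricting them to a
  -- countable exhaustion by smaller balls makes them finite at the cost of countably many null
  -- sets.
  let R : ℕ → ℝ := fun m => 1 - 1 / (m + 1)
  have hsub : ∀ m, Metric.closedBall (0 : EuclideanSpace ℝ (Fin n)) (R m) ⊆ Metric.ball 0 1 :=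
    fun m => Metric.closedBall_subset_ball (by
      have : (0 : ℝ) < 1 / (m + 1) := by positivity
      simp only [R]; linarith)
  have hfinp : ∀ m i j, IsFiniteMeasure ((μp i j).restrict (Metric.ball 0 (R m))) :=
    fun m i j => ⟨by
      rw [Measure.restrict_apply_univ]
      exact (measure_mono Metric.ball_subset_closedBall).trans_lt
        (hfin i j _ (hsub m) (isCompact_closedBall _ _)).1⟩
  have hfinm : ∀ m i j, IsFiniteMeasure ((μm i j).restrict (Metric.ball 0 (R m))) :=
    fun m i j => ⟨by
      rw [Measure.restrict_apply_univ]
      exact (measure_mono Metric.ball_subset_closedBall).trans_lt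
        (hfin i j _ (hsub m) (isCompact_closedBall _ _)).2⟩
  have hp := ae_all_iff.2 fun m => ae_all_iff.2 fun i => ae_all_iff.2 fun j =>
    ae_integral_sub_rnDeriv_le ((μp i j).restrict (Metric.ball 0 (R m)))
  have hm := ae_all_iff.2 fun m => ae_all_iff.2 fun i => ae_all_iff.2 fun j =>
    ae_integral_sub_rnDeriv_le ((μm i j).restrict (Metric.ball 0 (R m)))
  filter_upwards [hp, hm] with x₀ hp hm hx₀
  have hx1 : ‖x₀‖ < 1 := by simpa using hx₀
  obtain ⟨m, hRm⟩ := exists_nat_one_div_lt (sub_pos.2 hx1)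
  have hxR : ‖x₀‖ < R m := by simp only [R]; linarith
  refine ⟨Matrix.of fun i j =>
    (((μp i j).restrict (Metric.ball 0 (R m))).rnDeriv volume x₀).toReal -
      (((μm i j).restrict (Metric.ball 0 (R m))).rnDeriv volume x₀).toReal, ?_, fun ε hε => ?_⟩
  · ext i j
    simp [(hsym i j).1, (hsym i j).2]
  have hε2 : 0 < ε / 2 := by positivity
  have hp' : ∀ᶠ r in 𝓝[>] (0 : ℝ), ∀ i j, _ := eventually_all.2 fun i =>
    eventually_all.2 fun j => hp m i j (ε / 2) hε2
  have hm' : ∀ᶠ r in 𝓝[>] (0 : ℝ), ∀ i j, _ := eventually_all.2 fun i =>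
    eventually_all.2 fun j => hm m i j (ε / 2) hε2
  filter_upwards [hp', hm', nhdsWithin_le_nhds (eventually_lt_nhds (sub_pos.2 hxR))] with
    r hr1 hr2 hr i j φ hφ hφc hφs C hC
  have hsubR : tsupport φ ⊆ Metric.ball 0 (R m) := by
    refine hφs.trans fun z hz => ?_
    rw [mem_ball_zero_iff]
    rw [Metric.mem_ball, dist_eq_norm] at hz
    have := norm_le_norm_add_norm_sub' z x₀
    linarith
  have hsub1 : tsupport φ ⊆ Metric.ball 0 1 :=
    hsubR.trans (Metric.ball_subset_closedBall.trans (hsub m))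
  have hres : ∀ ν : Measure (EuclideanSpace ℝ (Fin n)),
      ∫ x in Metric.ball 0 1, φ x ∂ν = ∫ x in Metric.ball 0 (R m), φ x ∂ν := by
    intro ν
    rw [setIntegral_eq_integral_of_forall_compl_eq_zero fun x hx =>
        image_eq_zero_of_notMem_tsupport fun h => hx (hsub1 h),
      setIntegral_eq_integral_of_forall_compl_eq_zero fun x hx =>
        image_eq_zero_of_notMem_tsupport fun h => hx (hsubR h)]
  rw [hint i j φ hφ hφc hsub1, hres, hres]
  have h1 := hr1 i j φ hφ.continuous hφc hφs C hC
  have h2 := hr2 i j φ hφ.continuous hφc hφs C hC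
  simp only [Matrix.of_apply]
  rw [abs_le] at h1 h2 ⊢
  constructor <;> linarith

/-- Integration by parts, twice. -/
theorem integral_mul_hess {Q φ : EuclideanSpace ℝ (Fin n) → ℝ} (hQ : ContDiff ℝ 2 Q)
    (hφ : ContDiff ℝ ∞ φ) (hφc : HasCompactSupport φ) (i j : Fin n) :
    ∫ x, Q x * hess φ x i j = ∫ x, hess Q x j i * φ x := by
  have hg : ContDiff ℝ ∞ (fun y => fderiv ℝ φ y (EuclideanSpace.single j (1 : ℝ))) :=
    (hφ.fderiv_right (m := ∞) (by simp)).clm_apply contDiff_const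
  have hgc : HasCompactSupport (fun y => fderiv ℝ φ y (EuclideanSpace.single j (1 : ℝ))) :=
    hφc.fderiv_apply ℝ _
  have hq : ContDiff ℝ 1 (fun y => fderiv ℝ Q y (EuclideanSpace.single i (1 : ℝ))) :=
    (hQ.fderiv_right (m := 1) (by norm_num)).clm_apply contDiff_const
  have hg' : ContDiff ℝ ∞ (fun y => fderiv ℝ (fun y => fderiv ℝ φ y
      (EuclideanSpace.single j (1 : ℝ))) y (EuclideanSpace.single i (1 : ℝ))) :=
    (hg.fderiv_right (m := ∞) (by simp)).clm_apply contDiff_const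
  have hgc' : HasCompactSupport (fun y => fderiv ℝ (fun y => fderiv ℝ φ y
      (EuclideanSpace.single j (1 : ℝ))) y (EuclideanSpace.single i (1 : ℝ))) :=
    hgc.fderiv_apply ℝ _
  have hq' : Continuous (fun y => fderiv ℝ (fun y => fderiv ℝ Q y
      (EuclideanSpace.single i (1 : ℝ))) y (EuclideanSpace.single j (1 : ℝ))) :=
    (hq.continuous_fderiv one_ne_zero).clm_apply continuous_const
  simp only [hess, Matrix.of_apply]
  rw [integral_mul_fderiv_eq_neg_fderiv_mul_of_integrable
      ((hq.continuous.mul hg.continuous).integrable_of_hasCompactSupport hgc.mul_left)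
      ((hQ.continuous.mul hg'.continuous).integrable_of_hasCompactSupport hgc'.mul_left)
      ((hQ.continuous.mul hg.continuous).integrable_of_hasCompactSupport hgc.mul_left)
      (fun x _ => (hQ.differentiable (by norm_num)) x)
      (fun x _ => (hg.differentiable (by simp)) x),
    integral_mul_fderiv_eq_neg_fderiv_mul_of_integrable
      ((hq'.mul hφ.continuous).integrable_of_hasCompactSupport hφc.mul_left)
      ((hq.continuous.mul hg.continuous).integrable_of_hasCompactSupport hgc.mul_left)
      ((hq.continuous.mul hφ.continuous).integrable_of_hasCompactSupport hφc.mul_left)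
      (fun x _ => (hq.differentiable (by norm_num)) x)
      (fun x _ => (hφ.differentiable (by simp)) x), neg_neg]

end Differentiation

/-! ### Iteration over scales and convergence of the affine parts. -/

section AffineApproximation

variable {E : Type*} [NormedAddCommGroup E] [NormedSpace ℝ E]

/-- `v` is within `s * r ^ 2` of an affine function on the ball of radius `r` about `x₀`. -/
def AffineApprox (v : E → ℝ) (x₀ : E) (r s : ℝ) : Prop :=
  ∃ (a : ℝ) (b : E →L[ℝ] ℝ), ∀ y ∈ Metric.ball x₀ r, |v y - (a + b (y - x₀))| ≤ s * r ^ 2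

theorem AffineApprox.mono {v : E → ℝ} {x₀ : E} {r s t : ℝ} (h : AffineApprox v x₀ r s)
    (hst : s ≤ t) : AffineApprox v x₀ r t := by
  obtain ⟨a, b, hab⟩ := h
  exact ⟨a, b, fun y hy => (hab y hy).trans (by gcongr)⟩

/-- The improvement of affine approximations by a fixed factor, up to small errors, forces the
approximation error to tend to zero. -/
theorem affineApprox_eventually_of_improvement {v : E → ℝ} {x₀ : E} {r₀ M : ℝ} (hr₀ : 0 < r₀)
    (hM : ∀ y ∈ Metric.ball x₀ r₀, |v y| ≤ M)
    (himp : ∀ γ > 0, ∀ᶠ r in 𝓝[>] (0 : ℝ), ∀ s ≥ 0, AffineApprox v x₀ r s →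
      AffineApprox v x₀ (r / 4) ((s + γ) / 2)) {γ : ℝ} (hγ : 0 < γ) :
    ∀ᶠ j : ℕ in atTop, AffineApprox v x₀ (r₀ * (1 / 4) ^ j) γ := by
  have hM0 : 0 ≤ M := (abs_nonneg _).trans (hM x₀ (Metric.mem_ball_self hr₀))
  have hpos : ∀ j : ℕ, 0 < r₀ * (1 / 4 : ℝ) ^ j := fun j => by positivity
  have htend : Tendsto (fun j : ℕ => r₀ * (1 / 4 : ℝ) ^ j) atTop (𝓝[>] 0) := by
    refine tendsto_nhdsWithin_iff.2 ⟨?_, Eventually.of_forall hpos⟩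
    simpa using (tendsto_pow_atTop_nhds_zero_of_lt_one (by norm_num : (0 : ℝ) ≤ 1 / 4)
      (by norm_num)).const_mul r₀
  -- With error γ/2 the recursion s ↦ (s + γ/2)/2 has fixed point γ/2, so the iterates eventually
  -- fall below γ.
  obtain ⟨J, hJ⟩ := eventually_atTop.1 (htend.eventually (himp (γ / 2) (by positivity)))
  set s := M / (r₀ * (1 / 4) ^ J) ^ 2 with hs
  have hs0 : 0 ≤ s := by positivity
  have hbase : AffineApprox v x₀ (r₀ * (1 / 4) ^ J) s := by
    refine ⟨0, 0, fun y hy => ?_⟩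
    have hy' : y ∈ Metric.ball x₀ r₀ := by
      refine Metric.ball_subset_ball ?_ hy
      exact mul_le_of_le_one_right hr₀.le (pow_le_one₀ (by norm_num) (by norm_num))
    rw [hs, div_mul_cancel₀ _ (by have := hpos J; positivity)]
    simpa using hM y hy'
  have hind : ∀ i : ℕ, AffineApprox v x₀ (r₀ * (1 / 4) ^ (J + i)) (s * (1 / 2) ^ i + γ / 2) := by
    intro i
    induction i with
    | zero => exact hbase.mono (by simp; positivity)
    | succ i ih =>
      have h := hJ (J + i) (by omega) _ (by positivity) ih
      have e1 : r₀ * (1 / 4 : ℝ) ^ (J + i) / 4 = r₀ * (1 / 4) ^ (J + (i + 1)) := by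
        rw [← add_assoc, pow_succ]; ring
      rw [e1] at h
      exact h.mono (le_of_eq (by rw [pow_succ]; ring))
  have hlim : Tendsto (fun i : ℕ => s * (1 / 2 : ℝ) ^ i) atTop (𝓝 0) := by
    simpa using (tendsto_pow_atTop_nhds_zero_of_lt_one (by norm_num : (0 : ℝ) ≤ 1 / 2)
      (by norm_num)).const_mul s
  obtain ⟨I, hI⟩ := eventually_atTop.1 (hlim.eventually_lt_const (half_pos hγ))
  filter_upwards [eventually_ge_atTop (J + I)] with j hj
  obtain ⟨i, rfl⟩ : ∃ i, j = J + i := ⟨j - J, by omega⟩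
  exact (hind i).mono (by have := hI i (by omega); linarith)

/-- If `v` is approximated by affine functions on dyadic balls to second order, then the affine
functions can be taken to be the same at all scales. -/
theorem exists_affine_isLittleO_of_affineApprox {v : E → ℝ} {x₀ : E} {r₀ : ℝ} (hr₀ : 0 < r₀)
    (h : ∀ γ > 0, ∀ᶠ j : ℕ in atTop, AffineApprox v x₀ (r₀ * (1 / 4) ^ j) γ) :
    ∃ (a : ℝ) (b : E →L[ℝ] ℝ),
      (fun x => v x - (a + b (x - x₀))) =o[𝓝 x₀] fun x => ‖x - x₀‖ ^ 2 := by
  set r : ℕ → ℝ := fun j => r₀ * (1 / 4) ^ j with hr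
  have hrpos : ∀ j, 0 < r j := fun j => by simp only [hr]; positivity
  have hradd : ∀ j i, r (j + i) = r j * (1 / 4) ^ i := fun j i => by
    simp only [hr]; rw [pow_add]; ring
  set S : ℕ → Set ℝ := fun j => {s | 0 ≤ s ∧ AffineApprox v x₀ (r j) s} with hS
  -- A nearly optimal error at each scale: the affine functions are chosen once, independently of γ,
  -- and still satisfy every asymptotic bound. The term 1/(j+1) is slack, since the infimum need not
  -- be attained.
  set e : ℕ → ℝ := fun j => sInf (S j) + 1 / (j + 1) with he
  have hSb : ∀ j, BddBelow (S j) := fun j => ⟨0, fun s hs => hs.1⟩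
  have he0 : ∀ j, 0 ≤ e j := fun j => by
    have : 0 ≤ sInf (S j) := Real.sInf_nonneg fun s hs => hs.1
    simp only [he]; positivity
  have hele : ∀ γ > 0, ∀ᶠ j in atTop, e j ≤ γ := by
    intro γ hγ
    have h1 := tendsto_one_div_add_atTop_nhds_zero_nat.eventually_lt_const (half_pos hγ)
    filter_upwards [h (γ / 2) (half_pos hγ), h1] with j hj1 hj2
    have : sInf (S j) ≤ γ / 2 := csInf_le (hSb j) ⟨by positivity, hj1⟩
    simp only [he]; linarith
  have hchoose : ∀ j, ∃ (a : ℝ) (b : E →L[ℝ] ℝ), (S j).Nonempty →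
      ∀ y ∈ Metric.ball x₀ (r j), |v y - (a + b (y - x₀))| ≤ e j * r j ^ 2 := by
    intro j
    by_cases hne : (S j).Nonempty
    · obtain ⟨s, hs, hlt⟩ := exists_lt_of_csInf_lt hne
        (show sInf (S j) < e j by simp only [he]; have : (0 : ℝ) < 1 / (j + 1) := by positivity
                                  linarith)
      obtain ⟨a, b, hab⟩ := hs.2.mono hlt.le
      exact ⟨a, b, fun _ => hab⟩
    · exact ⟨0, 0, fun h => absurd h hne⟩
  choose a b hab using hchoose
  have hne : ∀ᶠ j in atTop, (S j).Nonempty :=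
    (h 1 one_pos).mono fun j hj => ⟨1, zero_le_one, hj⟩
  have hstep : ∀ γ > 0, ∀ᶠ j in atTop,
      (∀ y ∈ Metric.ball x₀ (r j), |v y - (a j + b j (y - x₀))| ≤ γ * r j ^ 2) ∧
      dist (a j) (a (j + 1)) ≤ 2 * γ * r j ^ 2 ∧ dist (b j) (b (j + 1)) ≤ 16 * γ * r j := by
    intro γ hγ
    have hev := (hele γ hγ).and hne
    filter_upwards [hev, (tendsto_add_atTop_nat 1).eventually hev] with j hj1 hj2
    have hv1 : ∀ y ∈ Metric.ball x₀ (r j), |v y - (a j + b j (y - x₀))| ≤ γ * r j ^ 2 :=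
      fun y hy => (hab j hj1.2 y hy).trans (by gcongr; exact hj1.1)
    have hrj : r (j + 1) = r j / 4 := by rw [hradd]; ring
    have hv2 : ∀ y ∈ Metric.ball x₀ (r j / 4),
        |v y - (a (j + 1) + b (j + 1) (y - x₀))| ≤ γ * r j ^ 2 := by
      intro y hy
      rw [← hrj] at hy
      refine (hab (j + 1) hj2.2 y hy).trans ?_
      have h1 : r (j + 1) ^ 2 ≤ r j ^ 2 := by
        rw [hrj]
        exact pow_le_pow_left₀ (by have := hrpos j; positivity) (by linarith [hrpos j]) 2
      exact mul_le_mul hj2.1 h1 (sq_nonneg _) hγ.le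
    have hdiff : ∀ y ∈ Metric.ball x₀ (r j / 4),
        |(a j - a (j + 1)) + (b j - b (j + 1)) (y - x₀)| ≤ 2 * γ * r j ^ 2 := by
      intro y hy
      have h1 := hv1 y (Metric.ball_subset_ball (by linarith [hrpos j]) hy)
      have h2 := hv2 y hy
      rw [sub_apply]
      rw [abs_le] at h1 h2 ⊢
      constructor <;> linarith
    have ha : |a j - a (j + 1)| ≤ 2 * γ * r j ^ 2 := by
      simpa using hdiff x₀ (Metric.mem_ball_self (by linarith [hrpos j]))
    refine ⟨hv1, ha, ?_⟩
    rw [dist_eq_norm]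
    refine ContinuousLinearMap.opNorm_le_of_ball (ε := r j / 4) (by linarith [hrpos j])
      (by have := hrpos j; positivity) fun z hz => ?_
    by_cases hz0 : z = 0
    · simp [hz0]
    have hzn : 0 < ‖z‖ := norm_pos_iff.2 hz0
    -- Evaluating at x₀ ± c z, inside the ball of radius `r j / 4`, removes the constant part and
    -- isolates the difference of the slopes.
    set c : ℝ := r j / 8 / ‖z‖ with hc
    have hc0 : 0 < c := by have := hrpos j; positivity
    have hcz : ‖c • z‖ = r j / 8 := by
      rw [norm_smul, Real.norm_of_nonneg hc0.le, hc]; field_simp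
    have h1 := hdiff (x₀ + c • z) (by
      rw [mem_ball_iff_norm, add_sub_cancel_left, hcz]; linarith [hrpos j])
    have h2 := hdiff (x₀ - c • z) (by
      rw [mem_ball_iff_norm, sub_sub_cancel_left, norm_neg, hcz]; linarith [hrpos j])
    rw [add_sub_cancel_left, map_smul, smul_eq_mul] at h1
    rw [sub_sub_cancel_left, map_neg, map_smul, smul_eq_mul] at h2
    set t := (b j - b (j + 1)) z with ht
    have h3 : c * |t| ≤ 2 * γ * r j ^ 2 := by
      rw [← abs_of_pos hc0, ← abs_mul]
      rw [abs_le] at h1 h2 ⊢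
      constructor <;> linarith
    rw [Real.norm_eq_abs]
    rw [hc] at h3
    have hrj0 := hrpos j
    have h4 : r j / 8 * |t| ≤ 2 * γ * r j ^ 2 * ‖z‖ := by
      have := mul_le_mul_of_nonneg_right h3 hzn.le
      have e1 : r j / 8 / ‖z‖ * |t| * ‖z‖ = r j / 8 * |t| := by field_simp
      linarith
    have h5 : r j / 8 * |t| ≤ r j / 8 * (16 * γ * r j * ‖z‖) := by linarith
    exact le_of_mul_le_mul_left h5 (by positivity)
  have hgeoA : ∀ {γ : ℝ} {j : ℕ}, (∀ i, dist (a (j + i)) (a (j + i + 1)) ≤ 2 * γ * r (j + i) ^ 2) →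
      ∀ i, dist (a (j + i)) (a (j + (i + 1))) ≤ 2 * γ * r j ^ 2 * (1 / 16) ^ i := by
    intro γ j hj i
    refine (hj i).trans (le_of_eq ?_)
    rw [hradd, mul_pow, ← pow_mul, mul_comm i 2, pow_mul]
    norm_num
    ring
  have hgeoB : ∀ {γ : ℝ} {j : ℕ}, (∀ i, dist (b (j + i)) (b (j + i + 1)) ≤ 16 * γ * r (j + i)) →
      ∀ i, dist (b (j + i)) (b (j + (i + 1))) ≤ 16 * γ * r j * (1 / 4) ^ i := by
    intro γ j hj i
    refine (hj i).trans (le_of_eq ?_)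
    rw [hradd]
    ring
  obtain ⟨J, hJ⟩ := eventually_atTop.1 (hstep 1 one_pos)
  obtain ⟨A, hA⟩ := cauchySeq_tendsto_of_complete
    (cauchySeq_of_le_geometric (1 / 16) _ (by norm_num)
    (hgeoA fun i => (hJ (J + i) (by omega)).2.1))
  obtain ⟨B, hB⟩ := cauchySeq_tendsto_of_complete
    (cauchySeq_of_le_geometric (1 / 4) _ (by norm_num)
    (hgeoB fun i => (hJ (J + i) (by omega)).2.2))
  have hA' : Tendsto a atTop (𝓝 A) := by
    refine (tendsto_add_atTop_iff_nat J).1 (hA.congr fun i => by rw [add_comm])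
  have hB' : Tendsto b atTop (𝓝 B) := by
    refine (tendsto_add_atTop_iff_nat J).1 (hB.congr fun i => by rw [add_comm])
  -- The geometric tails contribute 32/15 from the constants and 64/3 from the slopes; with the
  -- error at scale j itself the total stays below 30.
  have hfinal : ∀ γ > 0, ∃ J, ∀ j ≥ J, ∀ y ∈ Metric.ball x₀ (r j),
      |v y - (A + B (y - x₀))| ≤ 30 * γ * r j ^ 2 := by
    intro γ hγ
    obtain ⟨J, hJ⟩ := eventually_atTop.1 (hstep γ hγ)
    refine ⟨J, fun j hj y hy => ?_⟩
    have h1 := (hJ j hj).1 y hy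
    have h2 := dist_le_of_le_geometric_of_tendsto₀ (1 / 16) _ (by norm_num)
      (hgeoA fun i => (hJ (j + i) (by omega)).2.1)
      (hA'.comp (tendsto_add_atTop_nat j) |>.congr fun i => by simp [add_comm])
    have h3 := dist_le_of_le_geometric_of_tendsto₀ (1 / 4) _ (by norm_num)
      (hgeoB fun i => (hJ (j + i) (by omega)).2.2)
      (hB'.comp (tendsto_add_atTop_nat j) |>.congr fun i => by simp [add_comm])
    rw [add_zero, Real.dist_eq] at h2
    rw [add_zero, dist_eq_norm] at h3
    have hrj := hrpos j
    have h4 : |(b j - B) (y - x₀)| ≤ 22 * γ * r j ^ 2 := by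
      have hyn : ‖y - x₀‖ ≤ r j := (mem_ball_iff_norm.1 hy).le
      calc |(b j - B) (y - x₀)| ≤ ‖b j - B‖ * ‖y - x₀‖ := (b j - B).le_opNorm _
        _ ≤ (16 * γ * r j / (1 - 1 / 4)) * r j := by gcongr
        _ ≤ 22 * γ * r j ^ 2 := by
          have : 0 ≤ γ * r j ^ 2 := by positivity
          rw [show (16 * γ * r j / (1 - 1 / 4)) * r j = 64 / 3 * (γ * r j ^ 2) by ring]
          linarith
    have h5 : 2 * γ * r j ^ 2 / (1 - 1 / 16) = 32 / 15 * (γ * r j ^ 2) := by ring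
    rw [h5] at h2
    rw [sub_apply] at h4
    have h6 : 0 ≤ γ * r j ^ 2 := by positivity
    rw [abs_le] at h1 h2 h4 ⊢
    constructor <;> linarith
  refine ⟨A, B, ?_⟩
  -- The little-o bound includes x = x₀, where the right side vanishes, so exact equality is needed.
  have hx₀ : v x₀ - A = 0 := by
    obtain ⟨J, hJ⟩ := hfinal 1 one_pos
    have hlim : Tendsto (fun j => 30 * 1 * r j ^ 2) atTop (𝓝 0) := by
      have h1 : Tendsto r atTop (𝓝 0) := by
        simpa [hr] using (tendsto_pow_atTop_nhds_zero_of_lt_one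
          (by norm_num : (0 : ℝ) ≤ 1 / 4) (by norm_num)).const_mul r₀
      have h2 := (h1.pow 2).const_mul (30 * 1)
      rwa [zero_pow two_ne_zero, mul_zero] at h2
    have : |v x₀ - A| ≤ 0 := by
      refine ge_of_tendsto hlim (eventually_atTop.2 ⟨J, fun j hj => ?_⟩)
      simpa using hJ j hj x₀ (Metric.mem_ball_self (hrpos j))
    exact abs_nonpos_iff.1 this
  refine IsLittleO.of_bound fun c hc => ?_
  -- 1920 = 30 · 8²: the scale chosen for x has radius at most 8‖x - x₀‖. The factor 2 in the choice
  -- of m below puts x strictly inside the ball.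
  obtain ⟨J, hJ⟩ := hfinal (c / 1920) (by positivity)
  filter_upwards [Metric.ball_mem_nhds x₀ (show 0 < r J / 8 by have := hrpos J; positivity)]
    with x hx
  by_cases hxx : x = x₀
  · subst hxx; simpa using hx₀
  have ht : 0 < ‖x - x₀‖ := norm_pos_iff.2 (sub_ne_zero.2 hxx)
  have hxr : ‖x - x₀‖ < r J / 8 := mem_ball_iff_norm.1 hx
  have hrJ := hrpos J
  obtain ⟨m, hm1, hm2⟩ := exists_nat_pow_near_of_lt_one (x := 2 * ‖x - x₀‖ / r J)
    (y := (1 / 4 : ℝ)) (by positivity)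
    (by rw [div_le_one hrJ]; linarith) (by norm_num) (by norm_num)
  rw [lt_div_iff₀ hrJ] at hm1
  rw [div_le_iff₀ hrJ] at hm2
  have hrm : r (J + m) = r J * (1 / 4) ^ m := hradd J m
  have hrmp := hrpos (J + m)
  rw [pow_succ] at hm1
  have k1 : r (J + m) ≤ 8 * ‖x - x₀‖ := by rw [hrm]; linarith
  have k2 : ‖x - x₀‖ < r (J + m) := by rw [hrm]; rw [hrm] at hrmp; linarith
  have k3 := hJ (J + m) (by omega) x (mem_ball_iff_norm.2 k2)
  rw [Real.norm_eq_abs, Real.norm_of_nonneg (sq_nonneg _)]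
  have k4 : r (J + m) ^ 2 ≤ (8 * ‖x - x₀‖) ^ 2 := pow_le_pow_left₀ hrmp.le k1 2
  refine k3.trans ?_
  have := mul_le_mul_of_nonneg_left k4 (show 0 ≤ 30 * (c / 1920) by positivity)
  linarith

end AffineApproximation

/-! ### Quadratic and affine polynomials and their Hessians. -/

section Quadratic

variable {n : ℕ}

/-- The quadratic form `½ ⟨F x, x⟩` as a polynomial. -/
noncomputable def quadPoly (F : Matrix (Fin n) (Fin n) ℝ) : MvPolynomial (Fin n) ℝ :=
  ∑ i, ∑ j, MvPolynomial.C (F i j / 2) * (MvPolynomial.X i * MvPolynomial.X j)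

/-- The affine function `a + b (x - x₀)` as a polynomial. -/
noncomputable def affinePoly (a : ℝ) (b : EuclideanSpace ℝ (Fin n) →L[ℝ] ℝ)
    (x₀ : EuclideanSpace ℝ (Fin n)) : MvPolynomial (Fin n) ℝ :=
  MvPolynomial.C (a - b x₀) +
    ∑ i, MvPolynomial.C (b (EuclideanSpace.single i 1)) * MvPolynomial.X i

theorem totalDegree_quadPoly_le (F : Matrix (Fin n) (Fin n) ℝ) : (quadPoly F).totalDegree ≤ 2 := by
  refine (MvPolynomial.totalDegree_finsetSum_le fun i _ =>
    MvPolynomial.totalDegree_finsetSum_le fun j _ => ?_)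
  refine (MvPolynomial.totalDegree_mul _ _).trans ?_
  rw [MvPolynomial.totalDegree_C, zero_add]
  refine (MvPolynomial.totalDegree_mul _ _).trans ?_
  simp

theorem totalDegree_affinePoly_le (a : ℝ) (b : EuclideanSpace ℝ (Fin n) →L[ℝ] ℝ)
    (x₀ : EuclideanSpace ℝ (Fin n)) : (affinePoly a b x₀).totalDegree ≤ 2 := by
  refine (MvPolynomial.totalDegree_add _ _).trans
    (max_le (by rw [MvPolynomial.totalDegree_C]; omega) ?_)
  refine MvPolynomial.totalDegree_finsetSum_le fun i _ => ?_
  refine (MvPolynomial.totalDegree_mul _ _).trans ?_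
  simp

theorem eval_affinePoly (a : ℝ) (b : EuclideanSpace ℝ (Fin n) →L[ℝ] ℝ)
    (x₀ x : EuclideanSpace ℝ (Fin n)) :
    MvPolynomial.eval (fun i => x i) (affinePoly a b x₀) = a + b (x - x₀) := by
  have hsum : x = ∑ i, x i • EuclideanSpace.single i (1 : ℝ) := by
    ext j
    simp [Finset.sum_apply, Pi.single_apply]
  have hb : b x = ∑ i, b (EuclideanSpace.single i 1) * x i := by
    conv_lhs => rw [hsum]
    simp [map_sum, mul_comm]
  simp [affinePoly, hb]
  ring

/-- The quadratic form `½ ⟨F x, x⟩`. -/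
noncomputable def quad (F : Matrix (Fin n) (Fin n) ℝ) (x : EuclideanSpace ℝ (Fin n)) : ℝ :=
  MvPolynomial.eval (fun i => x i) (quadPoly F)

theorem quad_apply (F : Matrix (Fin n) (Fin n) ℝ) (x : EuclideanSpace ℝ (Fin n)) :
    quad F x = ∑ i, ∑ j, F i j / 2 * (x i * x j) := by
  simp [quad, quadPoly]

theorem contDiff_quad (F : Matrix (Fin n) (Fin n) ℝ) : ContDiff ℝ 2 (quad F) := by
  rw [show quad F = _ from funext (quad_apply F)]
  fun_prop

theorem hess_quad {F : Matrix (Fin n) (Fin n) ℝ} (hF : F.IsHermitian)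
    (x : EuclideanSpace ℝ (Fin n)) : hess (quad F) x = F := by
  have hc : ∀ (i : Fin n) (z : EuclideanSpace ℝ (Fin n)),
      HasFDerivAt (fun z : EuclideanSpace ℝ (Fin n) => z i)
        (EuclideanSpace.proj i : EuclideanSpace ℝ (Fin n) →L[ℝ] ℝ) z := fun i z =>
    (EuclideanSpace.proj i : EuclideanSpace ℝ (Fin n) →L[ℝ] ℝ).hasFDerivAt
  have hsymm : ∀ i j, F i j = F j i := fun i j => by simpa using hF.apply j i
  have h1 : ∀ (l : Fin n) (z : EuclideanSpace ℝ (Fin n)),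
      fderiv ℝ (quad F) z (EuclideanSpace.single l 1) = ∑ j, F l j * z j := by
    intro l z
    have hd : HasFDerivAt (fun z : EuclideanSpace ℝ (Fin n) =>
        ∑ i, ∑ j, F i j / 2 * (z i * z j)) _ z :=
      HasFDerivAt.fun_sum fun i _ => HasFDerivAt.fun_sum fun j _ =>
        ((hc i z).mul (hc j z)).const_mul (F i j / 2)
    have hp : ∀ i : Fin n, (EuclideanSpace.proj i : EuclideanSpace ℝ (Fin n) →L[ℝ] ℝ)
        (EuclideanSpace.single l 1) = if i = l then 1 else 0 := fun i => by simp
    rw [show quad F = _ from funext (quad_apply F), hd.fderiv]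
    simp only [sum_apply, smul_apply, add_apply, hp, smul_eq_mul, mul_add,
      Finset.sum_add_distrib, mul_ite, mul_one, mul_zero,
      Finset.sum_ite_eq', Finset.mem_univ, if_true]
    rw [Finset.sum_comm (f := fun i j => if i = l then F i j / 2 * z j else 0)]
    simp only [Finset.sum_ite_eq', Finset.mem_univ, if_true]
    rw [← Finset.sum_add_distrib]
    refine Finset.sum_congr rfl fun j _ => ?_
    rw [hsymm j l]
    ring
  ext i l
  simp only [hess, Matrix.of_apply]
  simp_rw [h1]
  have hd : HasFDerivAt (fun z : EuclideanSpace ℝ (Fin n) => ∑ j, F l j * z j) _ x :=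
    HasFDerivAt.fun_sum fun j _ => (hc j x).const_mul (F l j)
  rw [hd.fderiv]
  simp [PiLp.single_apply, hsymm l i]

theorem contDiff_affine (a : ℝ) (b : EuclideanSpace ℝ (Fin n) →L[ℝ] ℝ)
    (x₀ : EuclideanSpace ℝ (Fin n)) : ContDiff ℝ 2 fun x => a + b (x - x₀) := by
  fun_prop

theorem hess_affine (a : ℝ) (b : EuclideanSpace ℝ (Fin n) →L[ℝ] ℝ)
    (x₀ x : EuclideanSpace ℝ (Fin n)) : hess (fun x => a + b (x - x₀)) x = 0 := by
  have h1 : ∀ z, fderiv ℝ (fun x => a + b (x - x₀)) z = b := fun z => by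
    have : HasFDerivAt (fun x => a + b (x - x₀)) b z := by
      simpa using (b.hasFDerivAt.comp z ((hasFDerivAt_id z).sub_const x₀)).const_add a
    exact this.fderiv
  ext i j
  simp only [hess, Matrix.of_apply]
  simp_rw [h1]
  simp

theorem hess_eq_zero_of_notMem_tsupport {φ : EuclideanSpace ℝ (Fin n) → ℝ}
    {x : EuclideanSpace ℝ (Fin n)} (hx : x ∉ tsupport φ) (i j : Fin n) : hess φ x i j = 0 := by
  simp only [hess, Matrix.of_apply]
  refine image_eq_zero_of_notMem_tsupport (f := fun x => fderiv ℝ (fun y => fderiv ℝ φ y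
    (EuclideanSpace.single j (1 : ℝ))) x (EuclideanSpace.single i (1 : ℝ))) fun h => hx ?_
  exact tsupport_fderiv_apply_subset ℝ _ (tsupport_fderiv_apply_subset ℝ _ h)

theorem continuous_hess {φ : EuclideanSpace ℝ (Fin n) → ℝ} (hφ : ContDiff ℝ ∞ φ) (i j : Fin n) :
    Continuous fun x => hess φ x i j := by
  have h1 : ContDiff ℝ ∞ (fun y => fderiv ℝ φ y (EuclideanSpace.single j (1 : ℝ))) :=
    (hφ.fderiv_right (m := ∞) (by simp)).clm_apply contDiff_const
  have h2 : ContDiff ℝ ∞ (fun y => fderiv ℝ (fun y => fderiv ℝ φ y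
      (EuclideanSpace.single j (1 : ℝ))) y (EuclideanSpace.single i (1 : ℝ))) :=
    (h1.fderiv_right (m := ∞) (by simp)).clm_apply contDiff_const
  exact h2.continuous

end Quadratic

/-! ### One step of the improvement of affine approximation. -/

section Improvement

variable {n k : ℕ} {W : EuclideanSpace ℝ (Fin n) → Matrix (Fin n) (Fin n) ℝ}
  {w : EuclideanSpace ℝ (Fin n) → ℝ}

/-- Oscillation estimate at a small scale for a subsolution corrected by a quadratic function. -/
theorem abs_sub_le_of_subsolution (hkn : k ≤ n) (hk : n < 2 * k)
    (hW : ∀ x ∈ Metric.ball (0 : EuclideanSpace ℝ (Fin n)) 1, (W x).IsHermitian)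
    (hWd : ∀ x ∈ Metric.ball (0 : EuclideanSpace ℝ (Fin n)) 1, ∀ i j,
      |W x i j - (1 : Matrix (Fin n) (Fin n) ℝ) i j| ≤ pertSize n)
    (hw : IsViscositySubsolution k W w) {Q : EuclideanSpace ℝ (Fin n) → ℝ} (hQ : ContDiff ℝ 2 Q)
    {F : Matrix (Fin n) (Fin n) ℝ} (hQF : ∀ x, hess Q x = F) {L : ℝ} (hL0 : 0 < L)
    (hL : (L • (1 : Matrix (Fin n) (Fin n) ℝ) - F).PosSemidef)
    {x₀ : EuclideanSpace ℝ (Fin n)} {r η S : ℝ} (hr : 0 < r) (hη8 : η ≤ 1 / 8)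
    (hsub : Metric.ball x₀ r ⊆ Metric.ball 0 1)
    (hS : ∀ x ∈ Metric.ball x₀ r, |w x - Q x| ≤ S)
    {y z : EuclideanSpace ℝ (Fin n)} (hy : y ∈ Metric.ball x₀ (r / 4)) (hz : ‖z - y‖ < η * r) :
    |(w z - Q z) - (w y - Q y)| ≤ (2 * S + L * r ^ 2) * (16 * η ^ 2) ^ cuspExp n := by
  have hS0 : 0 ≤ S := (abs_nonneg _).trans (hS x₀ (Metric.mem_ball_self hr))
  have hK : 0 < 2 * S + L * r ^ 2 := by positivity
  have hηr : η * r ≤ r / 8 := by nlinarith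
  -- The barrier gives a one-sided bound. Allowing vertices in the ball of radius r/2 lets y and z
  -- exchange roles, which yields the bound on the absolute value.
  have key : ∀ p ∈ Metric.ball x₀ (r / 2), ∀ q, ‖q - p‖ < η * r →
      w q - Q q ≤ w p - Q p + (2 * S + L * r ^ 2) * (16 * η ^ 2) ^ cuspExp n := by
    intro p hp q hq
    have hpr : Metric.closedBall p (r / 4) ⊆ Metric.ball x₀ r := by
      intro t ht
      rw [Metric.mem_ball] at hp ⊢
      rw [Metric.mem_closedBall] at ht
      have := dist_triangle t p x₀
      linarith
    have h1 := le_cusp_barrier hkn hk hW hWd hw hQ hQF hL (y := p) (ρ := r / 4) (by positivity)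
      (hpr.trans hsub) hK (fun x hx => by
        have h2 := abs_le.1 (hS x (hpr (by
          rw [mem_closedBall_iff_norm]; exact hx.le)))
        have h3 := abs_le.1 (hS p (hpr (Metric.mem_closedBall_self (by positivity))))
        have : 0 < L * r ^ 2 := by positivity
        nlinarith) (x := q) (by rw [mem_closedBall_iff_norm]; linarith)
    have h2 : (‖q - p‖ ^ 2 / (r / 4) ^ 2) ^ cuspExp n ≤ (16 * η ^ 2) ^ cuspExp n := by
      refine Real.rpow_le_rpow (by positivity) ?_ (cuspExp_pos n).le
      rw [div_le_iff₀ (by positivity)]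
      have := pow_le_pow_left₀ (norm_nonneg _) hq.le 2
      linarith
    have h3 := mul_le_mul_of_nonneg_left h2 hK.le
    have h4 : 0 ≤ L / 2 * ‖q - p‖ ^ 2 := by positivity
    linarith
  rw [Metric.mem_ball] at hy
  have hz2 : z ∈ Metric.ball x₀ (r / 2) := by
    rw [Metric.mem_ball]
    have := dist_triangle z y x₀
    rw [dist_eq_norm z y] at this
    linarith
  have h1 := key y (by rw [Metric.mem_ball]; linarith) z hz
  have h2 := key z hz2 y (by rw [norm_sub_rev]; exact hz)
  rw [abs_le]
  constructor <;> linarith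

/-- At points where the distributional Hessian has an approximate value `F`, the affine
approximation of `w - ½ ⟨F x, x⟩` improves from one scale to the next. -/
theorem affineApprox_improvement (hkn : k ≤ n) (hk : n < 2 * k)
    (hW : ∀ x ∈ Metric.ball (0 : EuclideanSpace ℝ (Fin n)) 1, (W x).IsHermitian)
    (hWd : ∀ x ∈ Metric.ball (0 : EuclideanSpace ℝ (Fin n)) 1, ∀ i j,
      |W x i j - (1 : Matrix (Fin n) (Fin n) ℝ) i j| ≤ pertSize n)
    (hw : IsViscositySubsolution k W w) {x₀ : EuclideanSpace ℝ (Fin n)}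
    (hx₀ : x₀ ∈ Metric.ball (0 : EuclideanSpace ℝ (Fin n)) 1)
    {F : Matrix (Fin n) (Fin n) ℝ} (hF : F.IsHermitian)
    (hweak : ∀ ε > 0, ∀ᶠ r in 𝓝[>] (0 : ℝ),
        ∀ i j, ∀ φ : EuclideanSpace ℝ (Fin n) → ℝ, ContDiff ℝ ∞ φ → HasCompactSupport φ →
          tsupport φ ⊆ Metric.ball x₀ r → ∀ C, (∀ x, |φ x| ≤ C) →
            |(∫ x in Metric.ball 0 1, w x * hess φ x i j) - F i j * ∫ x, φ x| ≤
              ε * volume.real (Metric.closedBall x₀ r) * C) {γ : ℝ} (hγ : 0 < γ) :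
    ∀ᶠ r in 𝓝[>] (0 : ℝ), ∀ s ≥ 0, AffineApprox (fun x => w x - quad F x) x₀ r s →
      AffineApprox (fun x => w x - quad F x) x₀ (r / 4) ((s + γ) / 2) := by
  obtain ⟨L, hL0, hL⟩ := exists_smul_one_sub_posSemidef hF
  -- η depends only on n, γ and L, and not on s or r. It is fixed before ε, which must beat the loss
  -- (2/η)ⁿ from mollifying at scale ηr.
  obtain ⟨η, hη0, hη8, hη⟩ : ∃ η : ℝ, 0 < η ∧ η ≤ 1 / 8 ∧
      (16 * η ^ 2) ^ cuspExp n ≤ min (1 / 64) (γ / (64 * L)) := by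
    have hcont : Continuous fun η : ℝ => (16 * η ^ 2) ^ cuspExp n :=
      (by fun_prop : Continuous fun η : ℝ => 16 * η ^ 2).rpow_const
        fun _ => Or.inr (cuspExp_pos n).le
    have ht : Tendsto (fun η : ℝ => (16 * η ^ 2) ^ cuspExp n) (𝓝[>] 0) (𝓝 0) := by
      have := hcont.tendsto 0
      rw [zero_pow two_ne_zero, mul_zero, Real.zero_rpow (cuspExp_pos n).ne'] at this
      exact this.mono_left nhdsWithin_le_nhds
    have hmin : 0 < min (1 / 64) (γ / (64 * L)) := by positivity
    obtain ⟨η, h1, h2, h3⟩ := ((ht.eventually_lt_const hmin).and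
      (eventually_mem_nhdsWithin.and (nhdsWithin_le_nhds
        (eventually_le_nhds (show (0 : ℝ) < 1 / 8 by norm_num))))).exists
    exact ⟨η, h2, h3, h1.le⟩
  set σ := (16 * η ^ 2) ^ cuspExp n with hσ
  have hσ0 : 0 ≤ σ := by positivity
  have hσ1 : σ ≤ 1 / 64 := hη.trans (min_le_left _ _)
  have hσ2 : σ * L ≤ γ / 64 := by
    have := mul_le_mul_of_nonneg_right (hη.trans (min_le_right _ _)) hL0.le
    refine this.trans (le_of_eq ?_)
    field_simp
  set ε : ℝ := γ / 4 / ((n ^ 2 + 1) * (2 / η) ^ n) with hε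
  have hε0 : 0 < ε := by positivity
  have hεb : (n : ℝ) ^ 2 * (ε * (2 / η) ^ n) ≤ γ / 4 := by
    have h1 : (n ^ 2 + 1) * (ε * (2 / η) ^ n) = γ / 4 := by
      rw [hε]; field_simp
    have h2 : 0 ≤ ε * (2 / η) ^ n := by positivity
    nlinarith
  have hx1 : ‖x₀‖ < 1 := by simpa using hx₀
  filter_upwards [hweak ε hε0, self_mem_nhdsWithin,
    nhdsWithin_le_nhds (eventually_lt_nhds (sub_pos.2 hx1))] with r hr1 hr2 hr3 s hs happ
  have hr : 0 < r := hr2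
  obtain ⟨a, b, hab⟩ := happ
  have hcb : Metric.closedBall x₀ r ⊆ Metric.ball (0 : EuclideanSpace ℝ (Fin n)) 1 := by
    intro t ht
    rw [mem_ball_zero_iff]
    rw [mem_closedBall_iff_norm] at ht
    have := norm_le_norm_add_norm_sub' t x₀
    linarith
  have hb : Metric.ball x₀ r ⊆ Metric.ball (0 : EuclideanSpace ℝ (Fin n)) 1 :=
    Metric.ball_subset_closedBall.trans hcb
  set Q : EuclideanSpace ℝ (Fin n) → ℝ := fun x => quad F x + (a + b (x - x₀)) with hQ
  have hQd : ContDiff ℝ 2 Q := (contDiff_quad F).add (contDiff_affine a b x₀)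
  have hQF : ∀ x, hess Q x = F := fun x => by
    rw [hQ, hess_add (contDiff_quad F).contDiffAt (contDiff_affine a b x₀).contDiffAt,
      hess_quad hF, hess_affine, add_zero]
  have hS : ∀ x ∈ Metric.ball x₀ r, |w x - Q x| ≤ s * r ^ 2 := fun x hx => by
    have := hab x hx
    rwa [sub_sub] at this
  have hosc : ∀ y ∈ Metric.ball x₀ (r / 4), ∀ z, ‖z - y‖ < η * r →
      |(w z - Q z) - (w y - Q y)| ≤ (2 * (s * r ^ 2) + L * r ^ 2) * σ := fun y hy z hz =>
    abs_sub_le_of_subsolution hkn hk hW hWd hw hQd hQF hL0 hL hr hη8 hb hS hy hz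
  have hqc : ContinuousOn (fun x => w x - Q x) (Metric.closedBall x₀ r) :=
    (hw.1.mono hcb).sub hQd.continuous.continuousOn
  have hqi : IntegrableOn (fun x => w x - Q x) (Metric.ball x₀ r) :=
    (hqc.integrableOn_compact (isCompact_closedBall x₀ r)).mono_set Metric.ball_subset_closedBall
  have hweakq : ∀ i j, ∀ φ : EuclideanSpace ℝ (Fin n) → ℝ, ContDiff ℝ ∞ φ → HasCompactSupport φ →
      tsupport φ ⊆ Metric.ball x₀ r → ∀ C, (∀ x, |φ x| ≤ C) →
        |∫ x in Metric.ball x₀ r, (w x - Q x) * hess φ x i j| ≤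
          ε * volume.real (Metric.closedBall x₀ r) * C := by
    intro i j φ hφ hφc hφs C hC
    have hzero : ∀ x, x ∉ Metric.ball x₀ r → hess φ x i j = 0 := fun x hx =>
      hess_eq_zero_of_notMem_tsupport (fun h => hx (hφs h)) i j
    have e1 : ∫ x in Metric.ball x₀ r, (w x - Q x) * hess φ x i j =
        (∫ x in Metric.ball 0 1, w x * hess φ x i j) - F i j * ∫ x, φ x := by
      have hc := continuous_hess hφ i j
      have i1 : IntegrableOn (fun x => w x * hess φ x i j) (Metric.ball x₀ r) :=
        (((hw.1.mono hcb).mul hc.continuousOn).integrableOn_compact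
          (isCompact_closedBall x₀ r)).mono_set Metric.ball_subset_closedBall
      have i2 : IntegrableOn (fun x => Q x * hess φ x i j) (Metric.ball x₀ r) :=
        ((hQd.continuous.mul hc).continuousOn.integrableOn_compact
          (isCompact_closedBall x₀ r)).mono_set Metric.ball_subset_closedBall
      simp_rw [sub_mul]
      rw [integral_sub i1 i2]
      congr 1
      · rw [setIntegral_eq_integral_of_forall_compl_eq_zero fun x hx => by
            rw [hzero x hx, mul_zero],
          setIntegral_eq_integral_of_forall_compl_eq_zero fun x hx => by
            rw [hzero x fun h => hx (hb h), mul_zero]]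
      · rw [setIntegral_eq_integral_of_forall_compl_eq_zero fun x hx => by
            rw [hzero x hx, mul_zero], integral_mul_hess hQd hφ hφc]
        simp_rw [hQF]
        rw [integral_const_mul, show F j i = F i j by simpa using hF.apply i j]
    rw [e1]
    exact hr1 i j φ hφ hφc hφs C hC
  obtain ⟨a', b', hab'⟩ := exists_affine_of_weak_hess_le (τ := η * r) (by positivity)
    (by nlinarith) (by positivity) hqi hweakq hosc
  refine ⟨a + a', b + b', fun y hy => ?_⟩
  have h1 := hab' y hy
  have e2 : w y - Q y - (a' + b' (y - x₀)) =
      w y - quad F y - (a + a' + (b + b') (y - x₀)) := by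
    simp only [hQ, add_apply]; ring
  rw [e2] at h1
  refine h1.trans ?_
  have hvol : volume.real (Metric.closedBall x₀ r) *
      (1 / volume.real (Metric.closedBall (0 : EuclideanSpace ℝ (Fin n)) (η * r / 2))) =
        (2 / η) ^ n := by
    have hV : volume.real (Metric.ball (0 : EuclideanSpace ℝ (Fin n)) 1) ≠ 0 :=
      (ENNReal.toReal_pos (Metric.measure_ball_pos _ _ one_pos).ne' measure_ball_lt_top.ne).ne'
    have hτ : (η * r / 2) ^ n ≠ 0 := by positivity
    rw [Measure.addHaar_real_closedBall _ _ hr.le,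
      Measure.addHaar_real_closedBall _ _ (by positivity), finrank_euclideanSpace_fin,
      show 2 / η = r / (η * r / 2) by field_simp, div_pow r]
    generalize (η * r / 2) ^ n = t at hτ ⊢
    field_simp
  rw [mul_assoc ε, hvol]
  have h2 : (2 * (s * r ^ 2) + L * r ^ 2) * σ ≤ (s / 32 + γ / 64) * r ^ 2 := by
    have : 2 * s * σ + σ * L ≤ s / 32 + γ / 64 := by nlinarith
    have := mul_le_mul_of_nonneg_right this (sq_nonneg r)
    linarith
  have h3 := mul_le_mul_of_nonneg_right hεb (sq_nonneg (r / 4))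
  have h4 : 0 ≤ γ * r ^ 2 := by positivity
  -- The oscillation error (s/32 + γ/64) r² and the Hessian error (γ/4)(r/4)² = γ r²/64 add up to
  -- exactly ((s + γ)/2)(r/4)².
  linarith

end Improvement

end SigmaK

/-! ### Conclusion. -/

theorem theorem4 (n k : ℕ) (hkn : k ≤ n) (hk : (n : ℝ) / 2 < (k : ℝ)) :
    ∃ δ : ℝ, 0 < δ ∧
      ∀ (W : EuclideanSpace ℝ (Fin n) → Matrix (Fin n) (Fin n) ℝ)
        (w : EuclideanSpace ℝ (Fin n) → ℝ),
        (∀ i j, ContDiffOn ℝ 2 (fun x => W x i j) (Metric.closedBall 0 1)) →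
        (∀ x ∈ Metric.closedBall (0 : EuclideanSpace ℝ (Fin n)) 1, (W x).PosDef) →
        (∃ K : NNReal, LipschitzOnWith K w (Metric.ball 0 1)) →
        SigmaK.IsViscositySubsolution k W w →
        SigmaK.SecondDerivsAreMeasures w →
        (∀ x ∈ Metric.ball (0 : EuclideanSpace ℝ (Fin n)) 1, ∀ i j,
          |W x i j - (1 : Matrix (Fin n) (Fin n) ℝ) i j| ≤ δ) →
        ∀ᵐ x ∂(volume.restrict (Metric.ball (0 : EuclideanSpace ℝ (Fin n)) 1)),
          SigmaK.PunctuallySecondOrderDifferentiableAt w x := by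
  have hk2 : n < 2 * k := by
    have : (n : ℝ) < 2 * k := by linarith
    exact_mod_cast this
  have hn : 1 ≤ n := by omega
  have hδ : 0 < SigmaK.pertSize n := by
    have : (0 : ℝ) < n := by exact_mod_cast hn
    unfold SigmaK.pertSize
    positivity
  refine ⟨SigmaK.pertSize n, hδ, fun W w _ hWp _ hw hsd hWd => ?_⟩
  rw [ae_restrict_iff' Metric.isOpen_ball.measurableSet]
  filter_upwards [SigmaK.ae_exists_weak_hess hsd] with x₀ hx hx₀
  obtain ⟨F, hF, hweak⟩ := hx hx₀
  have hW : ∀ x ∈ Metric.ball (0 : EuclideanSpace ℝ (Fin n)) 1, (W x).IsHermitian := fun x hx =>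
    (hWp x (Metric.ball_subset_closedBall hx)).isHermitian
  obtain ⟨r₀, hr₀, hsub⟩ := Metric.nhds_basis_closedBall.mem_iff.1
    (Metric.isOpen_ball.mem_nhds hx₀)
  have hcont : ContinuousOn (fun x => w x - SigmaK.quad F x) (Metric.closedBall x₀ r₀) :=
    (hw.1.mono hsub).sub (SigmaK.contDiff_quad F).continuous.continuousOn
  -- A bound on v is all the iteration needs to start: zero is then an affine approximation with
  -- some finite, possibly huge, relative error.
  obtain ⟨M, hM⟩ := (isCompact_closedBall x₀ r₀).exists_bound_of_continuousOn hcont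
  obtain ⟨a, b, hab⟩ := SigmaK.exists_affine_isLittleO_of_affineApprox hr₀ fun γ hγ =>
    SigmaK.affineApprox_eventually_of_improvement (v := fun x => w x - SigmaK.quad F x) hr₀
      (fun y hy => hM y (Metric.ball_subset_closedBall hy))
      (fun γ hγ => SigmaK.affineApprox_improvement hkn hk2 hW hWd hw hx₀ hF hweak hγ) hγ
  refine ⟨SigmaK.quadPoly F + SigmaK.affinePoly a b x₀,
    (MvPolynomial.totalDegree_add _ _).trans
      (max_le (SigmaK.totalDegree_quadPoly_le F) (SigmaK.totalDegree_affinePoly_le a b x₀)), ?_⟩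
  refine hab.congr_left fun x => ?_
  rw [map_add, SigmaK.eval_affinePoly, SigmaK.quad]
  ring
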